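/- Let $d\ge 2$, let $\mathcal X_1,\dots,\mathcal X_d$ be compact metric spaces, and let $X=(X^{(1)},\dots,X^{(d)})$ be a random variable with values in $\mathcal X=\mathcal X_1\times\cdots\times\mathcal X_d$. For each $\ell$ let $\mathcal H_\ell$ be a reproducing kernel Hilbert space of real functions on $\mathcal X_\ell$ with measurable kernel $K_\ell$, and let $\mathcal H=\mathcal H_1\otimes\cdots\otimes\mathcal H_d$ be the Hilbert space tensor product, i.e. the completion of the span of the functions $(f_1\otimes\cdots\otimes f_d)(x)=\prod_{\ell}f_\ell(x_\ell)$, $f_\ell\in\mathcal H_\ell$, for the inner product with $\langle f_1\otimes\cdots\otimes f_d,\,g_1\otimes\cdots\otimes g_d\rangle_{\mathcal H}=\prod_\ell\langle f_\ell,g_\ell\rangle_{\mathcal H_\ell}$; it is the reproducing kernel Hilbert space on $\mathcal X$ with kernel $K(x,y)=\prod_{\ell}K_\ell(x_\ell,y_\ell)$. Assume - $(\mathscr A_1)$ $\sup_{t,s\in\mathcal X_\ell}K_\ell(t,s)<+\infty$ for $\ell=1,\dots,d$. Put $m_\ell=\mathbb E\,K_\ell(X^{(\ell)},\cdot)\in\mathcal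 H_\ell$, $m=\mathbb E\,K(X,\cdot)\in\mathcal H$ (expectations in the weak sense: $\langle m_\ell,f\rangle=\mathbb E f(X^{(\ell)})$ for all $f\in\mathcal H_\ell$, and likewise for $m$), $\nu=m_1\otimes\cdots\otimes m_d$, and $d\mathrm{HSIC}(X)=\|m-\nu\|_{\mathcal H}^2$. Let $X_1,X_2,\dots$ be i.i.d. copies of $X$, $X_i=(X_i^{(1)},\dots,X_i^{(d)})$. For $\gamma\in\,]0,1]$ let $(w_{i,n}(\gamma))_{1\le i\le n}$ be nonnegative real numbers such that - $(\mathscr A_2)$ for every $\gamma\in\,]0,1]$ there are $\tau>0$ and $n_0$ with $n\left|\frac1n\sum_{i=1}^n w_{i,n}(\gamma)-1\right|\le\tau$ for all $n>n_0$; - $(\mathscr A_3)$ there is $C>0$ with $\max_{1\le i\le n}w_{i,n}(\gamma)<C$ for all $n\ge 1$ and all $\gamma\in\,]0,1]$; - $(\mathscr A_4)$ for every $\gamma\in\,]0,1]$, $\lim_{n\to\infty}\frac1n\sum_{i=1}^n w_{i,n}(\gamma)^2=w^2(\gamma)>1$. Define $$\widehat{\mathbf D}_{\gamma,n}=\frac1{n^2}\sum_{i,j=1}^n\prod_{\ell=1}^dK_\ell(X_i^{(\ell)},X_j^{(\ell)})+\frac1{n^{2d}}\prod_{\ell=1}^d\sum_{i,j=1}^nK_\ell(X_i^{(\ell)},X_j^{(\ell)})-\frac2{n^{d+1}}\sum_{i=1}^nw_{i,n}(\gamma)\prod_{\ell=1}^d\sum_{j=1}^nK_\ell(X_i^{(\ell)},X_j^{(\ell)}),$$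 and, for $x=(x_1,\dots,x_d)\in\mathcal X$, $$\mathcal U(x)=\Big\langle\sum_{\ell=1}^d m_1\otimes\cdots\otimes m_{\ell-1}\otimes K_\ell(x_\ell,\cdot)\otimes m_{\ell+1}\otimes\cdots\otimes m_d-d\,\nu,\ \nu-m\Big\rangle_{\mathcal H}+\big\langle K(x,\cdot)-m,\,m\big\rangle_{\mathcal H},\qquad \mathcal V(x)=\big\langle K(x,\cdot)-m,\,\nu\big\rangle_{\mathcal H}.$$ Then the mean embeddings $m_\ell$ and $m$ exist, $\mathcal U(X_1)$ and $\mathcal V(X_1)$ are square integrable, and for every $\gamma\in\,]0,1]$, as $n\to+\infty$, $$\sqrt n\,\big(\widehat{\mathbf D}_{\gamma,n}-d\mathrm{HSIC}(X)\big)\ \xrightarrow{\ \mathscr D\ }\ \mathcal N(0,\sigma_\gamma^2),\qquad \sigma_\gamma^2=4\,\mathrm{Var}(\mathcal U(X_1))+4w^2(\gamma)\,\mathrm{Var}(\mathcal V(X_1))-8\,\mathrm{Cov}(\mathcal U(X_1),\mathcal V(X_1))\ge 0,$$ where $\mathcal N(0,0)$ denotes the point mass at $0$. If moreover $X^{(1)},\dots,X^{(d)}$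 are jointly independent, i.e. $\mathbb P_X=\mathbb P_{X^{(1)}}\otimes\cdots\otimes\mathbb P_{X^{(d)}}$, then $$\sqrt n\,\widehat{\mathbf D}_{\gamma,n}\ \xrightarrow{\ \mathscr D\ }\ \mathcal N\big(0,\,4(w^2(\gamma)-1)\,\mathrm{Var}(\mathcal V(X_1))\big).$$ -/

import Mathlib

open MeasureTheory ProbabilityTheory Filter Topology
open scoped InnerProductSpace

namespace DHSIC

noncomputable section

/-! ### Kernels of a real reproducing kernel Hilbert space -/

/-- The element `K(x, ·)` of a real reproducing kernel Hilbert space. -/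
def kfun (H : Type*) {X : Type*} [NormedAddCommGroup H] [InnerProductSpace ℝ H]
    [CompleteSpace H] [RKHS ℝ H X ℝ] (x : X) : H :=
  RKHS.kerFun H x 1

/-- The kernel `K(x, y)` of a real reproducing kernel Hilbert space. -/
def kval (H : Type*) {X : Type*} [NormedAddCommGroup H] [InnerProductSpace ℝ H]
    [CompleteSpace H] [RKHS ℝ H X ℝ] (x y : X) : ℝ :=
  kfun H x y

/-- The reproducing property. -/
theorem inner_kfun {H X : Type*} [NormedAddCommGroup H] [InnerProductSpace ℝ H]
    [CompleteSpace H] [RKHS ℝ H X ℝ] (x : X) (f : H) : ⟪kfun H x, f⟫_ℝ = f x := by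
  simp [kfun]

/-! ### The tensor product of reproducing kernel Hilbert spaces -/

section Tensor

variable {ι : Type*} (H : ι → Type*)
  [∀ l, NormedAddCommGroup (H l)] [∀ l, InnerProductSpace ℝ (H l)]

/-- The form `⟨f₁ ⊗ ⋯ ⊗ f_d, g₁ ⊗ ⋯ ⊗ g_d⟩ = ∏ₗ ⟨fₗ, gₗ⟩` on elementary tensors. -/
def gram [Fintype ι] : Matrix (∀ l, H l) (∀ l, H l) (ℝ →L[ℝ] ℝ) :=
  Matrix.of fun f g => (∏ l, ⟪f l, g l⟫_ℝ) • (1 : ℝ →L[ℝ] ℝ)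

theorem posSemidef_prod_inner (s : Finset ι) :
    (Matrix.of fun f g : (∀ l, H l) => ∏ l ∈ s, ⟪f l, g l⟫_ℝ).PosSemidef := by
  classical
  induction s using Finset.induction_on with
  | empty =>
    refine ⟨by ext; simp, fun x => ?_⟩
    have : (x.sum fun i xi => x.sum fun j xj => star xi *
        (Matrix.of fun f g : (∀ l, H l) => ∏ l ∈ (∅ : Finset ι), ⟪f l, g l⟫_ℝ) i j * xj)
        = (x.sum fun _ a => a) * (x.sum fun _ a => a) := by
      simp [Finsupp.sum, Finset.sum_mul_sum]
    rw [this]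
    exact mul_self_nonneg _
  | insert a s ha ih =>
    have h1 : (Matrix.of fun f g : (∀ l, H l) => ⟪f a, g a⟫_ℝ).PosSemidef := by
      refine ⟨by ext; simp [real_inner_comm], fun x => ?_⟩
      have : (x.sum fun i xi => x.sum fun j xj => star xi *
          (Matrix.of fun f g : (∀ l, H l) => ⟪f a, g a⟫_ℝ) i j * xj)
          = ⟪x.sum fun i xi => xi • i a, x.sum fun i xi => xi • i a⟫_ℝ := by
        simp only [Finsupp.sum, sum_inner, inner_sum, real_inner_smul_left,
          real_inner_smul_right, Matrix.of_apply, star_trivial]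
        refine Finset.sum_congr rfl fun i _ => Finset.sum_congr rfl fun j _ => ?_
        rw [real_inner_comm (i a)]
        ring
      rw [this]
      exact real_inner_self_nonneg
    have e : (Matrix.of fun f g : (∀ l, H l) => ∏ l ∈ insert a s, ⟪f l, g l⟫_ℝ)
        = (Matrix.of fun f g : (∀ l, H l) => ⟪f a, g a⟫_ℝ).hadamard
          (Matrix.of fun f g : (∀ l, H l) => ∏ l ∈ s, ⟪f l, g l⟫_ℝ) := by
      ext f g
      simp [Finset.prod_insert ha]
    rw [e]
    exact h1.hadamard ih

variable [Fintype ι]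

instance gram_posSemidef : Fact (gram H).PosSemidef := by
  have hiff := (RKHS.posSemidef_tfae (K := gram H)).out 0 2
  refine ⟨hiff.mpr ?_⟩
  refine ⟨?_, fun f => ?_⟩
  · ext f g
    simp [gram, real_inner_comm]
  · have h := (posSemidef_prod_inner H Finset.univ).2 f
    simp only [gram, Matrix.of_apply, star_trivial] at h ⊢
    refine h.trans_eq ?_
    simp only [Finsupp.sum, RCLike.re_to_real]
    refine Finset.sum_congr rfl fun i _ => Finset.sum_congr rfl fun j _ => ?_
    simp [real_inner_comm]
    ring

/-- The Hilbert space tensor product `H₁ ⊗ ⋯ ⊗ H_d`: the free real vector space on the symbols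
`f₁ ⊗ ⋯ ⊗ f_d`, completed (after dividing out the null vectors) for the inner product determined
by `⟨f₁ ⊗ ⋯ ⊗ f_d, g₁ ⊗ ⋯ ⊗ g_d⟩ = ∏ₗ ⟨fₗ, gₗ⟩`. The facts below show that it is a Hilbert space
of functions on the product of the domains, in which `f₁ ⊗ ⋯ ⊗ f_d` is the function
`x ↦ ∏ₗ fₗ (xₗ)`, and that these functions span a dense subspace. -/
def TensorHilbert : Type _ := RKHS.OfKernel (gram H)

instance : NormedAddCommGroup (TensorHilbert H) :=
  inferInstanceAs (NormedAddCommGroup (RKHS.OfKernel (gram H)))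

instance : InnerProductSpace ℝ (TensorHilbert H) :=
  inferInstanceAs (InnerProductSpace ℝ (RKHS.OfKernel (gram H)))

instance : CompleteSpace (TensorHilbert H) :=
  inferInstanceAs (CompleteSpace (RKHS.OfKernel (gram H)))

variable {H}

/-- The elementary tensor `f₁ ⊗ ⋯ ⊗ f_d`. -/
def tprod (f : ∀ l, H l) : TensorHilbert H :=
  (RKHS.kerFun (RKHS.OfKernel (gram H)) f 1 : RKHS.OfKernel (gram H))

theorem inner_tprod (f g : ∀ l, H l) : ⟪tprod f, tprod g⟫_ℝ = ∏ l, ⟪f l, g l⟫_ℝ := by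
  have h := RKHS.kernel_inner (RKHS.OfKernel (gram H)) g f (1 : ℝ) (1 : ℝ)
  rw [RKHS.OfKernel.kernel_ofKernel] at h
  refine h.symm.trans ?_
  simp [gram, real_inner_comm]

/-- A vector orthogonal to all elementary tensors vanishes: their span is dense. -/
theorem eq_zero_of_inner_tprod {h : TensorHilbert H} (hh : ∀ f, ⟪tprod f, h⟫_ℝ = 0) : h = 0 := by
  refine RKHS.ext (H := RKHS.OfKernel (gram H)) fun f => ?_
  have h1 := hh f
  have h2 := RKHS.kerFun_inner (H := RKHS.OfKernel (gram H)) f (1 : ℝ) h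
  rw [show (0 : TensorHilbert H) = (0 : RKHS.OfKernel (gram H)) from rfl, RKHS.coe_zero]
  have h3 : ⟪(1 : ℝ), (show RKHS.OfKernel (gram H) from h) f⟫_ℝ = 0 := h2.symm.trans h1
  simpa using h3

/-- The elementary tensors span a dense subspace. -/
theorem dense_span_tprod :
    (Submodule.span ℝ (Set.range (tprod : (∀ l, H l) → TensorHilbert H))).topologicalClosure
      = ⊤ := by
  refine Submodule.orthogonal_eq_bot_iff.mp ((Submodule.eq_bot_iff _).mpr fun h hh => ?_)
  refine eq_zero_of_inner_tprod fun f => ?_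
  exact hh _ (subset_closure (Submodule.subset_span ⟨f, rfl⟩))

theorem inner_tprod_update [DecidableEq ι] (f g : ∀ l, H l) (a : ι) (u : H a) :
    ⟪tprod g, tprod (Function.update f a u)⟫_ℝ
      = ⟪g a, u⟫_ℝ * ∏ l ∈ Finset.univ.erase a, ⟪g l, f l⟫_ℝ := by
  rw [inner_tprod, ← Finset.mul_prod_erase _ _ (Finset.mem_univ a), Function.update_self]
  congr 1
  exact Finset.prod_congr rfl fun x hx => by
    rw [Function.update_of_ne (Finset.ne_of_mem_erase hx)]

/-- The elementary tensor is a continuous linear function of each factor. -/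
def tprodSlot [DecidableEq ι] (f : ∀ l, H l) (a : ι) : H a →L[ℝ] TensorHilbert H :=
  LinearMap.mkContinuous
    { toFun := fun u => tprod (Function.update f a u)
      map_add' := fun u v => by
        rw [← sub_eq_zero]
        refine eq_zero_of_inner_tprod fun g => ?_
        simp only [inner_sub_right, inner_add_right, inner_tprod_update]
        ring
      map_smul' := fun c u => by
        rw [← sub_eq_zero]
        refine eq_zero_of_inner_tprod fun g => ?_
        simp only [inner_sub_right, inner_smul_right, inner_tprod_update, RingHom.id_apply]
        ring }
    (∏ l ∈ Finset.univ.erase a, ‖f l‖) fun u => by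
      refine le_of_sq_le_sq ?_ (by positivity)
      have h := inner_tprod_update f (Function.update f a u) a u
      rw [real_inner_self_eq_norm_sq, Function.update_self, real_inner_self_eq_norm_sq] at h
      change ‖tprod (Function.update f a u)‖ ^ 2 ≤ _
      rw [h, mul_pow, mul_comm, ← Finset.prod_pow]
      refine le_of_eq (congrArg (· * _) (Finset.prod_congr rfl fun x hx => ?_))
      rw [Function.update_of_ne (Finset.ne_of_mem_erase hx), real_inner_self_eq_norm_sq]

theorem tprodSlot_apply [DecidableEq ι] (f : ∀ l, H l) (a : ι) (u : H a) :
    tprodSlot f a u = tprod (Function.update f a u) := rfl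

variable {X : ι → Type*} [∀ l, CompleteSpace (H l)] [∀ l, RKHS ℝ (H l) (X l) ℝ]

/-- A vector orthogonal to all tensors of kernel functions vanishes. -/
theorem eq_zero_of_inner_tprod_kfun {h : TensorHilbert H}
    (hh : ∀ x : ∀ l, X l, ⟪tprod (fun l => kfun (H l) (x l)), h⟫_ℝ = 0) : h = 0 := by
  classical
  suffices key : ∀ s : Finset ι, ∀ f : ∀ l, H l, (∀ l ∉ s, ∃ x : X l, f l = kfun (H l) x) →
      ⟪tprod f, h⟫_ℝ = 0 from
    eq_zero_of_inner_tprod fun f => key Finset.univ f fun l hl => absurd (Finset.mem_univ l) hl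
  intro s
  induction s using Finset.induction_on with
  | empty =>
    intro f hf
    choose x hx using fun l => hf l (Finset.notMem_empty l)
    rw [show f = fun l => kfun (H l) (x l) from funext hx]
    exact hh x
  | insert a s ha ih =>
    intro f hf
    have hφ : (tprodSlot f a).adjoint h = 0 := by
      refine RKHS.ext fun x => ?_
      rw [← inner_kfun, ContinuousLinearMap.adjoint_inner_right, tprodSlot_apply, RKHS.coe_zero]
      refine ih _ fun l hl => ?_
      by_cases hla : l = a
      · subst hla
        exact ⟨x, Function.update_self ..⟩
      · rw [Function.update_of_ne hla]
        exact hf l (by simp [hla, hl])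
    have h2 := ContinuousLinearMap.adjoint_inner_right (tprodSlot f a) (f a) h
    rw [hφ, inner_zero_right, tprodSlot_apply, Function.update_eq_self] at h2
    exact h2.symm

/-- `H₁ ⊗ ⋯ ⊗ H_d` as a reproducing kernel Hilbert space of functions on `X₁ × ⋯ × X_d`; the value
of `h` at `x` is `⟨K₁(x₁, ·) ⊗ ⋯ ⊗ K_d(x_d, ·), h⟩`. -/
instance : RKHS ℝ (TensorHilbert H) (∀ l, X l) ℝ where
  coeCLM := ContinuousLinearMap.pi fun x => innerSL ℝ (tprod fun l => kfun (H l) (x l))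
  coeCLM_injective := by
    refine (injective_iff_map_eq_zero _).mpr fun h hh => ?_
    exact eq_zero_of_inner_tprod_kfun (X := X) fun x => congrFun hh x

/-- `f₁ ⊗ ⋯ ⊗ f_d` is the function `x ↦ ∏ₗ fₗ (xₗ)`. -/
theorem tprod_apply (f : ∀ l, H l) (x : ∀ l, X l) : (tprod f : TensorHilbert H) x = ∏ l, f l (x l) := by
  have : (tprod f : TensorHilbert H) x
      = ⟪(tprod fun l => kfun (H l) (x l) : TensorHilbert H), tprod f⟫_ℝ := rfl
  rw [this, inner_tprod]
  simp only [inner_kfun]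

/-- `K(x, ·) = K₁(x₁, ·) ⊗ ⋯ ⊗ K_d(x_d, ·)`. -/
theorem kfun_tensor (x : ∀ l, X l) :
    kfun (TensorHilbert H) x = tprod fun l => kfun (H l) (x l) := by
  refine ext_inner_right ℝ fun h => ?_
  rw [inner_kfun]
  rfl

/-- `K(x, y) = ∏ₗ Kₗ(xₗ, yₗ)`. -/
theorem kval_tensor (x y : ∀ l, X l) :
    kval (TensorHilbert H) x y = ∏ l, kval (H l) (x l) (y l) := by
  rw [kval, kfun_tensor, tprod_apply]
  rfl

end Tensor

/-! ### Mean embeddings and the `d`-variable Hilbert-Schmidt independence criterion -/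

/-- `m` is the expectation of the Hilbert space valued random variable `Z`:
`E ⟨Z, f⟩ = ⟨m, f⟩` for all `f`, with `⟨Z, f⟩` integrable. Such an `m` is unique. -/
def IsMean {Ω E : Type*} [MeasurableSpace Ω] [NormedAddCommGroup E] [InnerProductSpace ℝ E]
    (P : Measure Ω) (Z : Ω → E) (m : E) : Prop :=
  ∀ f : E, Integrable (fun ω => ⟪Z ω, f⟫_ℝ) P ∧ ∫ ω, ⟪Z ω, f⟫_ℝ ∂P = ⟪m, f⟫_ℝ

/-- The expectation of a Hilbert space valued random variable. -/
def mean {Ω E : Type*} [MeasurableSpace Ω] [NormedAddCommGroup E] [InnerProductSpace ℝ E]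
    (P : Measure Ω) (Z : Ω → E) : E :=
  Classical.epsilon (IsMean P Z)

theorem IsMean.mean_eq {Ω E : Type*} [MeasurableSpace Ω] [NormedAddCommGroup E]
    [InnerProductSpace ℝ E] {P : Measure Ω} {Z : Ω → E} {m : E} (h : IsMean P Z m) :
    mean P Z = m := by
  have h' : IsMean P Z (mean P Z) := Classical.epsilon_spec ⟨m, h⟩
  exact ext_inner_right ℝ fun f => (h' f).2.symm.trans (h f).2

/-- For a Bochner integrable variable, the expectation is the Bochner integral. -/
theorem mean_eq_integral {Ω E : Type*} [MeasurableSpace Ω] [NormedAddCommGroup E]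
    [InnerProductSpace ℝ E] [CompleteSpace E] {P : Measure Ω} {Z : Ω → E} (h : Integrable Z P) :
    mean P Z = ∫ ω, Z ω ∂P := by
  refine IsMean.mean_eq fun f => ⟨h.inner_const f, ?_⟩
  have h2 := integral_inner (𝕜 := ℝ) h f
  simp only [real_inner_comm f] at h2 ⊢
  exact h2

section Criterion

variable {d : ℕ} {𝒳 : Fin d → Type*} (H : Fin d → Type*)
  [∀ l, NormedAddCommGroup (H l)] [∀ l, InnerProductSpace ℝ (H l)] [∀ l, CompleteSpace (H l)]
  [∀ l, RKHS ℝ (H l) (𝒳 l) ℝ]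
  {Ω : Type*} [MeasurableSpace Ω] (P : Measure Ω) (X : Ω → ∀ l, 𝒳 l)

/-- The mean embedding `mₗ = E Kₗ(X⁽ˡ⁾, ·)` in `Hₗ`. -/
def margMean (l : Fin d) : H l := mean P fun ω => kfun (H l) (X ω l)

/-- The mean embedding `m = E K(X, ·)` in `H₁ ⊗ ⋯ ⊗ H_d`. -/
def jointMean : TensorHilbert H := mean P fun ω => kfun (TensorHilbert H) (X ω)

/-- The tensor product `ν = m₁ ⊗ ⋯ ⊗ m_d`. -/
def prodMean : TensorHilbert H := tprod (margMean H P X)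

/-- `dHSIC(X) = ‖m - m₁ ⊗ ⋯ ⊗ m_d‖²`. -/
def dHSIC : ℝ := ‖jointMean H P X - prodMean H P X‖ ^ 2

/-- `U(x) = ⟨∑ₗ m₁ ⊗ ⋯ ⊗ Kₗ(xₗ, ·) ⊗ ⋯ ⊗ m_d - d ν, ν - m⟩ + ⟨K(x, ·) - m, m⟩`, where in the `l`-th
summand the `l`-th factor `mₗ` is replaced by `Kₗ(xₗ, ·)`. -/
def U (x : ∀ l, 𝒳 l) : ℝ :=
  ⟪(∑ l, tprod (Function.update (margMean H P X) l (kfun (H l) (x l))))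
      - (d : ℝ) • prodMean H P X, prodMean H P X - jointMean H P X⟫_ℝ
    + ⟪kfun (TensorHilbert H) x - jointMean H P X, jointMean H P X⟫_ℝ

/-- `V(x) = ⟨K(x, ·) - m, ν⟩`. -/
def V (x : ∀ l, 𝒳 l) : ℝ :=
  ⟪kfun (TensorHilbert H) x - jointMean H P X, prodMean H P X⟫_ℝ

/-- The modified estimator of `dHSIC(X)` with weights `w₁, …, wₙ` computed from the observations
`x₁, …, xₙ`. -/
def estimator {n : ℕ} (w : Fin n → ℝ) (x : Fin n → ∀ l, 𝒳 l) : ℝ :=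
  1 / (n : ℝ) ^ 2 * ∑ i, ∑ j, ∏ l, kval (H l) (x i l) (x j l)
    + 1 / (n : ℝ) ^ (2 * d) * ∏ l, ∑ i, ∑ j, kval (H l) (x i l) (x j l)
    - 2 / (n : ℝ) ^ (d + 1) * ∑ i, w i * ∏ l, ∑ j, kval (H l) (x i l) (x j l)

/-- `σ²_γ`, as a function of `W = w²(γ)`, with `Y` an observation distributed as `X`. -/
def asympVar (W : ℝ) (Y : Ω → ∀ l, 𝒳 l) : ℝ :=
  4 * Var[fun ω => U H P X (Y ω); P] + 4 * W * Var[fun ω => V H P X (Y ω); P]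
    - 8 * cov[fun ω => U H P X (Y ω), fun ω => V H P X (Y ω); P]

end Criterion

/-- The conditions on the weights: `w γ n i` is the weight of the `i`-th of `n` observations and
`w2 γ` is the limit `w²(γ)`. -/
structure WeightConditions (w : ℝ → (n : ℕ) → Fin n → ℝ) (w2 : ℝ → ℝ) : Prop where
  nonneg : ∀ γ ∈ Set.Ioc (0 : ℝ) 1, ∀ n i, 0 ≤ w γ n i
  mean_bound : ∀ γ ∈ Set.Ioc (0 : ℝ) 1, ∃ τ > 0, ∃ n₀ : ℕ, ∀ n > n₀,
    (n : ℝ) * |1 / (n : ℝ) * ∑ i, w γ n i - 1| ≤ τ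
  bounded : ∃ C > 0, ∀ n, ∀ γ ∈ Set.Ioc (0 : ℝ) 1, ∀ i, w γ n i < C
  tendsto_sq : ∀ γ ∈ Set.Ioc (0 : ℝ) 1,
    Tendsto (fun n : ℕ => 1 / (n : ℝ) * ∑ i, w γ n i ^ 2) atTop (𝓝 (w2 γ))
  one_lt : ∀ γ ∈ Set.Ioc (0 : ℝ) 1, 1 < w2 γ

end

end DHSIC

namespace DHSIC

/-! ### A central limit theorem for bounded triangular arrays -/

/-! Write `m̂` for the average of the kernel functions at the observations, `m̂_w` for the weighted
average, and `ν̂` for the tensor product of the marginal averages. The estimator is `‖m̂‖² + ‖ν̂‖² -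
2⟨m̂_w, ν̂⟩` (`estimator_eq`), to be compared with `‖m - ν‖²`. Expanding around `m` and `ν`, with
`ν̂ - ν` replaced by its derivative in the `d` factors, leaves the average of `2 (U - w V)`, terms
quadratic in the centred averages, and a multiple of the bias of the mean weight
(`abs_estimator_sub_linear_le`).

Centred kernel functions at independent observations are orthogonal in mean, so a centred average
has expected squared norm of order `1/n` (`integral_norm_centredAvg_sq_le`). The weight bias has the
same order by assumption. After multiplication by `√n` the remainder tends to zero in probability
(`tendstoInMeasure_remainder`), and Slutsky's lemma reduces the claim to the linear part.

The variables `2 (U(X_i) - w_i V(X_i))` are independent, centred and uniformly bounded, but not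
identically distributed, hence a triangular array version of the central limit theorem, proved with
characteristic functions. Their second moments are quadratic polynomials in `w_i`; the averages of
`w_i` and `w_i²` tend to `1` and `w²(γ)`, which gives the variance (`tendstoInDistribution_linear`).
Under joint independence `m = ν`, so the criterion is `0` and `U = V`, and only the part of the
variance due to `w²(γ) - 1` survives.

The Hilbert spaces are not assumed separable, so no Bochner integral of the kernel functions is
used: means are weak, and measurability is only needed for real functions such as `⟪k_x - m, k_y -
m⟫`. -/

theorem norm_prod_sub_prod_le {ι : Type*} (s : Finset ι) (a b : ι → ℂ)
    (ha : ∀ i, ‖a i‖ ≤ 1) (hb : ∀ i, ‖b i‖ ≤ 1) :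
    ‖∏ i ∈ s, a i - ∏ i ∈ s, b i‖ ≤ ∑ i ∈ s, ‖a i - b i‖ := by
  classical
  induction s using Finset.induction_on with
  | empty => simp
  | insert i s hi ih =>
    rw [Finset.prod_insert hi, Finset.prod_insert hi, Finset.sum_insert hi]
    -- Telescoping: change one factor at a time, the remaining factors having modulus at most one.
    have e : a i * ∏ j ∈ s, a j - b i * ∏ j ∈ s, b j
        = (a i - b i) * ∏ j ∈ s, a j + b i * (∏ j ∈ s, a j - ∏ j ∈ s, b j) := by ring
    have h1 : ‖∏ j ∈ s, a j‖ ≤ 1 := by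
      rw [norm_prod]
      exact Finset.prod_le_one (fun _ _ => norm_nonneg _) fun j _ => ha j
    rw [e]
    refine (norm_add_le _ _).trans (add_le_add ?_ ?_)
    · rw [norm_mul]
      exact mul_le_of_le_one_right (norm_nonneg _) h1
    · rw [norm_mul]
      exact (mul_le_of_le_one_left (norm_nonneg _) (hb i)).trans ih

/-- Taylor expansion of the exponential to third order under the integral; centring removes the
linear term. The error is explicit in `s` and `B`, so it is uniform over a row of the array. -/
theorem norm_charFun_sub_le {Ω : Type*} [MeasurableSpace Ω] {P : Measure Ω}
    [IsProbabilityMeasure P] {Z : Ω → ℝ} (hZ : AEMeasurable Z P) {B : ℝ}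
    (hB : ∀ ω, |Z ω| ≤ B) (h0 : ∫ ω, Z ω ∂P = 0) (s : ℝ) :
    ‖charFun (P.map Z) s - ((1 - s ^ 2 / 2 * ∫ ω, Z ω ^ 2 ∂P : ℝ) : ℂ)‖
      ≤ (|s| * B) ^ 3 * Real.exp (|s| * B) := by
  have iZ : Integrable Z P := .of_bound hZ.aestronglyMeasurable B (ae_of_all _ hB)
  have iZ2 : Integrable (fun ω => Z ω ^ 2) P :=
    .of_bound (hZ.pow_const 2).aestronglyMeasurable (B ^ 2) (ae_of_all _ fun ω => by
      rw [Real.norm_eq_abs, abs_pow]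
      exact pow_le_pow_left₀ (abs_nonneg _) (hB ω) 2)
  have m1 : AEStronglyMeasurable (fun ω => Complex.exp (s * Z ω * Complex.I)) P := by
    have : AEMeasurable (fun ω => Complex.exp (s * Z ω * Complex.I)) P := by fun_prop
    exact this.aestronglyMeasurable
  have iE : Integrable (fun ω => Complex.exp (s * Z ω * Complex.I)) P :=
    .of_bound m1 1 (ae_of_all _ fun ω => by
      rw [← Complex.ofReal_mul, Complex.norm_exp_ofReal_mul_I])
  have e1 : charFun (P.map Z) s = ∫ ω, Complex.exp (s * Z ω * Complex.I) ∂P := by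
    rw [charFun_apply_real, integral_map hZ (by fun_prop)]
  have e2 : ((1 - s ^ 2 / 2 * ∫ ω, Z ω ^ 2 ∂P : ℝ) : ℂ)
      = ∫ ω, (1 + (s * Complex.I) * (Z ω : ℂ) - (s : ℂ) ^ 2 / 2 * ((Z ω ^ 2 : ℝ) : ℂ)) ∂P := by
    rw [integral_sub ((integrable_const _).add (iZ.ofReal.const_mul _)) (iZ2.ofReal.const_mul _),
      integral_add (integrable_const _) (iZ.ofReal.const_mul _), integral_const_mul,
      integral_const_mul, integral_complex_ofReal, integral_complex_ofReal, h0]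
    simp
  have iT : Integrable (fun ω => 1 + (s * Complex.I) * (Z ω : ℂ)
      - (s : ℂ) ^ 2 / 2 * ((Z ω ^ 2 : ℝ) : ℂ)) P :=
    ((integrable_const _).add (iZ.ofReal.const_mul _)).sub (iZ2.ofReal.const_mul _)
  rw [e1, e2, ← integral_sub iE iT]
  refine (norm_integral_le_of_norm_le_const (C := (|s| * B) ^ 3 * Real.exp (|s| * B))
    (ae_of_all _ fun ω => ?_)).trans (by simp)
  have h := Complex.norm_exp_sub_sum_le_norm_mul_exp (s * Z ω * Complex.I) 3
  have hn : ‖(s * Z ω * Complex.I : ℂ)‖ ≤ |s| * B := by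
    simpa using mul_le_mul_of_nonneg_left (hB ω) (abs_nonneg s)
  refine le_trans (le_of_eq ?_) (h.trans ?_)
  · congr 2
    simp only [Finset.sum_range_succ, Finset.sum_range_zero, Nat.factorial]
    push_cast
    ring_nf
    simp
    ring
  · have : 0 ≤ |s| * B := (norm_nonneg _).trans hn
    gcongr

theorem abs_exp_neg_sub_le {y : ℝ} (hy : 0 ≤ y) :
    |Real.exp (-y) - (1 - y)| ≤ y ^ 2 * Real.exp y := by
  have h := Complex.norm_exp_sub_sum_le_norm_mul_exp ((-y : ℝ) : ℂ) 2
  have e : Complex.exp ((-y : ℝ) : ℂ) - ∑ m ∈ Finset.range 2, ((-y : ℝ) : ℂ) ^ m / (m.factorial : ℂ)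
      = ((Real.exp (-y) - (1 - y) : ℝ) : ℂ) := by
    simp [Finset.sum_range_succ]
    ring
  rw [e, Complex.norm_real, Complex.norm_real] at h
  simpa [abs_of_nonneg hy] using h

/-- The central limit theorem for a uniformly bounded triangular array of centred variables that
are independent in each row. -/
theorem tendstoInDistribution_bounded_array {Ω : Type*} [MeasurableSpace Ω] {P : Measure Ω}
    [IsProbabilityMeasure P] {Z : (n : ℕ) → Fin n → Ω → ℝ}
    (hindep : ∀ n, iIndepFun (Z n) P) (hm : ∀ n i, AEMeasurable (Z n i) P)
    {B : ℝ} (hB : ∀ n i ω, |Z n i ω| ≤ B) (h0 : ∀ n i, ∫ ω, Z n i ω ∂P = 0) {v : ℝ} (hv : 0 ≤ v)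
    (hlim : Tendsto (fun n : ℕ => 1 / (n : ℝ) * ∑ i, ∫ ω, Z n i ω ^ 2 ∂P) atTop (𝓝 v)) :
    TendstoInDistribution (fun (n : ℕ) ω => (√(n : ℝ))⁻¹ * ∑ i, Z n i ω) atTop id (fun _ => P)
      (gaussianReal 0 v.toNNReal) where
  forall_aemeasurable n := .const_mul (Finset.aemeasurable_fun_sum _ fun i _ => hm n i) _
  tendsto := by
    refine ProbabilityMeasure.tendsto_iff_tendsto_charFun.2 fun t => ?_
    have hB' : ∀ n : ℕ, 0 < n → 0 ≤ B := fun n hn => (abs_nonneg _).trans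
      (hB n ⟨0, hn⟩ (Classical.choice (P.nonempty_of_neZero)))
    set q : (n : ℕ) → Fin n → ℝ := fun n i => ∫ ω, Z n i ω ^ 2 ∂P with hq
    have q0 : ∀ n i, 0 ≤ q n i := fun n i => integral_nonneg fun ω => sq_nonneg _
    have qB : ∀ n i, q n i ≤ B ^ 2 := fun n i => by
      have := norm_integral_le_of_norm_le_const (μ := P) (f := fun ω => Z n i ω ^ 2) (C := B ^ 2)
        (ae_of_all _ fun ω => by
          rw [Real.norm_eq_abs, abs_pow]
          exact pow_le_pow_left₀ (abs_nonneg _) (hB n i ω) 2)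
      simp only [probReal_univ, mul_one] at this
      exact (le_abs_self _).trans this
    have e1 : ∀ n : ℕ, charFun (P.map fun ω => (√(n : ℝ))⁻¹ * ∑ i, Z n i ω) t
        = ∏ i, charFun (P.map (Z n i)) ((√(n : ℝ))⁻¹ * t) := fun n => by
      rw [charFun_map_mul_comp (Finset.aemeasurable_fun_sum _ fun i _ => hm n i),
        ((hindep n).restrict Finset.univ).charFun_map_fun_finsetSum_eq_prod
          (fun i _ => hm n i), Finset.prod_apply]
    -- Gaussian factors with the variances of the `Z n i`: their product depends on the row only
    -- through the average variance, which converges.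
    set b : (n : ℕ) → Fin n → ℂ := fun n i =>
      ((Real.exp (-(((√(n : ℝ))⁻¹ * t) ^ 2 / 2 * q n i)) : ℝ) : ℂ) with hb
    have hbprod : Tendsto (fun n => ∏ i, b n i) atTop
        (𝓝 (charFun (gaussianReal 0 v.toNNReal) t)) := by
      have e2 : ∀ n, ∏ i, b n i
          = ((Real.exp (-(t ^ 2 / 2 * (1 / (n : ℝ) * ∑ i, q n i))) : ℝ) : ℂ) := fun n => by
        simp only [hb]
        rw [← Complex.ofReal_prod, ← Real.exp_sum, Finset.sum_neg_distrib, ← Finset.mul_sum,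
          mul_pow, inv_pow, Real.sq_sqrt (Nat.cast_nonneg n)]
        congr 3
        ring
      have e3 : charFun (gaussianReal 0 v.toNNReal) t = ((Real.exp (-(t ^ 2 / 2 * v)) : ℝ) : ℂ) := by
        rw [charFun_gaussianReal, Real.coe_toNNReal v hv]
        push_cast
        congr 1
        ring
      simp_rw [e2, e3]
      exact (Complex.continuous_ofReal.tendsto _).comp
        ((Real.continuous_exp.tendsto _).comp ((hlim.const_mul _).neg))
    have hdiff : Tendsto (fun n : ℕ => charFun (P.map fun ω => (√(n : ℝ))⁻¹ * ∑ i, Z n i ω) t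
        - ∏ i, b n i) atTop (𝓝 0) := by
      -- With `r = 1/√n`, each factor costs `r³ C₁` from the Taylor error and `r⁴ C₂` from the
      -- Gaussian factor. Summing `n = r⁻²` of them leaves `r C₁ + r² C₂`.
      set C₁ := (|t| * B) ^ 3 * Real.exp (|t| * B) with hC₁
      set C₂ := (t ^ 2 / 2 * B ^ 2) ^ 2 * Real.exp (t ^ 2 / 2 * B ^ 2) with hC₂
      have hs0 : Tendsto (fun n : ℕ => (√(n : ℝ))⁻¹) atTop (𝓝 0) :=
        tendsto_inv_atTop_zero.comp (Real.tendsto_sqrt_atTop.comp tendsto_natCast_atTop_atTop)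
      refine squeeze_zero_norm' (a := fun n : ℕ => (√(n : ℝ))⁻¹ * C₁ + (√(n : ℝ))⁻¹ ^ 2 * C₂) ?_ ?_
      · filter_upwards [eventually_gt_atTop 0] with n hn
        have hBn := hB' n hn
        set r := (√(n : ℝ))⁻¹ with hr
        have hr0 : 0 ≤ r := by positivity
        have hr1 : r ≤ 1 := by
          refine inv_le_one_of_one_le₀ ?_
          rw [Real.one_le_sqrt]
          exact_mod_cast hn
        have hrn : (n : ℝ) * r ^ 2 = 1 := by
          rw [hr, inv_pow, Real.sq_sqrt (Nat.cast_nonneg n)]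
          field_simp
        rw [e1]
        refine (norm_prod_sub_prod_le _ _ _ (fun i => ?_) fun i => ?_).trans ?_
        · have := Measure.isProbabilityMeasure_map (hm n i)
          exact norm_charFun_le_one _
        · rw [hb, Complex.norm_real, Real.norm_eq_abs, Real.abs_exp, Real.exp_le_one_iff, neg_nonpos]
          have := q0 n i
          positivity
        have hterm : ∀ i, ‖charFun (P.map (Z n i)) (r * t) - b n i‖ ≤ r ^ 3 * C₁ + r ^ 4 * C₂ := by
          intro i
          have h1 := norm_charFun_sub_le (hm n i) (hB n i) (h0 n i) (r * t)
          have hq0 := q0 n i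
          have hqB := qB n i
          have h2 := abs_exp_neg_sub_le (y := (r * t) ^ 2 / 2 * q n i) (by positivity)
          have h1' : (|r * t| * B) ^ 3 * Real.exp (|r * t| * B) ≤ r ^ 3 * C₁ := by
            rw [abs_mul, abs_of_nonneg hr0, hC₁, ← mul_assoc, ← mul_pow, mul_assoc r]
            refine mul_le_mul_of_nonneg_left (Real.exp_le_exp.2 ?_) (by positivity)
            exact mul_le_of_le_one_left (by positivity) hr1
          have h2' : ((r * t) ^ 2 / 2 * q n i) ^ 2 * Real.exp ((r * t) ^ 2 / 2 * q n i)
              ≤ r ^ 4 * C₂ := by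
            have hy : (r * t) ^ 2 / 2 * q n i ≤ r ^ 2 * (t ^ 2 / 2 * B ^ 2) := by
              calc (r * t) ^ 2 / 2 * q n i ≤ (r * t) ^ 2 / 2 * B ^ 2 := by gcongr
                _ = _ := by ring
            calc _ ≤ (r ^ 2 * (t ^ 2 / 2 * B ^ 2)) ^ 2 * Real.exp (t ^ 2 / 2 * B ^ 2) := by
                  refine mul_le_mul (pow_le_pow_left₀ (by positivity) hy 2) (Real.exp_le_exp.2 ?_)
                    (Real.exp_pos _).le (by positivity)
                  exact hy.trans (mul_le_of_le_one_left (by positivity) (pow_le_one₀ hr0 hr1))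
              _ = _ := by rw [hC₂]; ring
          have e4 : charFun (P.map (Z n i)) (r * t) - b n i
              = (charFun (P.map (Z n i)) (r * t) - ((1 - (r * t) ^ 2 / 2 * q n i : ℝ) : ℂ))
                - ((Real.exp (-((r * t) ^ 2 / 2 * q n i)) - (1 - (r * t) ^ 2 / 2 * q n i) : ℝ) : ℂ) := by
            simp only [hb, ← hr]
            push_cast
            ring
          rw [e4]
          refine (norm_sub_le _ _).trans (add_le_add (h1.trans h1') ?_)
          rw [Complex.norm_real]
          exact h2.trans h2'
        refine (Finset.sum_le_sum fun i _ => hterm i).trans (le_of_eq ?_)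
        rw [Finset.sum_const, Finset.card_univ, Fintype.card_fin, nsmul_eq_mul]
        linear_combination (r * C₁ + r ^ 2 * C₂) * hrn
      · simpa using (hs0.mul_const C₁).add ((hs0.pow 2).mul_const C₂)
    have := hdiff.add hbprod
    simpa using this

/-! ### Weak means of kernel functions -/

section RKHSMean

variable {Y E : Type*} [NormedAddCommGroup E] [InnerProductSpace ℝ E] [CompleteSpace E]
  [RKHS ℝ E Y ℝ]

theorem inner_kfun_kfun (x y : Y) : ⟪kfun E x, kfun E y⟫_ℝ = kval E x y := by
  rw [real_inner_comm, inner_kfun]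
  rfl

/-- `‖k_x‖² = K(x, x)`. A bound at least `1` is taken so that it dominates its own square root and
its powers increase. -/
theorem exists_norm_kfun_le (h : BddAbove (Set.range fun p : Y × Y => kval E p.1 p.2)) :
    ∃ B : ℝ, 1 ≤ B ∧ ∀ x, ‖kfun E x‖ ≤ B := by
  obtain ⟨b, hb⟩ := h
  refine ⟨max 1 b, le_max_left _ _, fun x => le_of_sq_le_sq ?_ (by positivity)⟩
  have h1 : kval E x x ≤ b := hb ⟨(x, x), rfl⟩
  rw [← inner_kfun_kfun, real_inner_self_eq_norm_sq] at h1
  nlinarith [le_max_left 1 b, le_max_right 1 b]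

theorem abs_apply_le {B : ℝ} (hB : ∀ x, ‖kfun E x‖ ≤ B) (f : E) (x : Y) : |f x| ≤ B * ‖f‖ := by
  rw [← inner_kfun]
  exact (abs_real_inner_le_norm _ _).trans (by gcongr; exact hB x)

/-- The right side contains only values of the kernel and of `m`, which makes the left side
measurable in `(x, y)`. -/
theorem inner_kfun_sub_kfun_sub (m : E) (x y : Y) :
    ⟪kfun E x - m, kfun E y - m⟫_ℝ = kval E x y - m x - m y + ‖m‖ ^ 2 := by
  rw [inner_sub_left, inner_sub_right, inner_sub_right, inner_kfun_kfun, inner_kfun,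
    real_inner_comm, inner_kfun, real_inner_self_eq_norm_sq]
  ring

theorem abs_inner_kfun_sub_le {m : E} {B : ℝ} (hB : ∀ x, ‖kfun E x‖ ≤ B) (hmB : ‖m‖ ≤ B)
    (x y : Y) : |⟪kfun E x - m, kfun E y - m⟫_ℝ| ≤ (2 * B) ^ 2 := by
  have h : ∀ x, ‖kfun E x - m‖ ≤ 2 * B := fun x =>
    (norm_sub_le _ _).trans (by linarith [hB x])
  refine (abs_real_inner_le_norm _ _).trans ?_
  rw [sq]
  exact mul_le_mul (h x) (h y) (norm_nonneg _) ((norm_nonneg _).trans (h x))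

/-- The weighted average of the centred kernel functions at the observations. -/
noncomputable def centredAvg {n : ℕ} (m : E) (a : Fin n → ℝ) (x : Fin n → Y) : E :=
  (1 / (n : ℝ)) • ∑ i, a i • (kfun E (x i) - m)

theorem norm_centredAvg_sq {n : ℕ} (m : E) (a : Fin n → ℝ) (x : Fin n → Y) :
    ‖centredAvg m a x‖ ^ 2 = (1 / (n : ℝ)) ^ 2 *
      ∑ i, ∑ j, a i * a j * ⟪kfun E (x i) - m, kfun E (x j) - m⟫_ℝ := by
  rw [← real_inner_self_eq_norm_sq, centredAvg, inner_smul_left, inner_smul_right, sum_inner]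
  simp only [inner_sum, inner_smul_left, inner_smul_right, conj_trivial]
  rw [← mul_assoc, ← sq]
  congr 1
  refine Finset.sum_congr rfl fun i _ => Finset.sum_congr rfl fun j _ => ?_
  ring

theorem integral_apply_eq {Ω : Type*} [MeasurableSpace Ω] {P : Measure Ω} {X : Ω → Y} {m : E} (hm : IsMean P (fun ω => kfun E (X ω)) m) (f : E) :
    ∫ ω, f (X ω) ∂P = ⟪m, f⟫_ℝ := by
  rw [← (hm f).2]
  simp only [inner_kfun]

/-- Testing the weak mean against `m` itself gives `‖m‖² = E m(X) ≤ B ‖m‖`. -/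
theorem norm_mean_le {Ω : Type*} [MeasurableSpace Ω] {P : Measure Ω}
    [IsProbabilityMeasure P] {X : Ω → Y} {m : E} (hm : IsMean P (fun ω => kfun E (X ω)) m) {B : ℝ}
    (hB : ∀ x, ‖kfun E x‖ ≤ B) : ‖m‖ ≤ B := by
  obtain ⟨ω⟩ := P.nonempty_of_neZero
  have hB0 : 0 ≤ B := (norm_nonneg _).trans (hB (X ω))
  have h := norm_integral_le_of_norm_le_const (μ := P) (f := fun ω => m (X ω)) (C := B * ‖m‖)
    (ae_of_all _ fun _ => abs_apply_le hB m _)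
  rw [integral_apply_eq hm, real_inner_self_eq_norm_sq] at h
  simp only [norm_pow, norm_norm, probReal_univ, mul_one] at h
  by_contra! hlt
  nlinarith

variable [MeasurableSpace Y]

/-- The elements of a reproducing kernel Hilbert space with measurable kernel are measurable. -/
theorem measurable_of_kernel (hK : Measurable fun p : Y × Y => kval E p.1 p.2) (f : E) :
    Measurable (f : Y → ℝ) := by
  -- Kernel functions span a dense subspace, and convergence in norm implies pointwise convergence.
  have hf : f ∈ (Submodule.span ℝ {RKHS.kerFun E x v | (x : Y) (v : ℝ)}).topologicalClosure := by
    rw [RKHS.kerFun_dense]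
    trivial
  obtain ⟨g, hg, hlim⟩ := mem_closure_iff_seq_limit.1 hf
  refine measurable_of_tendsto_metrizable (f := fun n => (g n : Y → ℝ)) (fun n => ?_)
    (tendsto_pi_nhds.2 fun y => ((RKHS.continuous_eval y).tendsto f).comp hlim)
  refine Submodule.span_induction (p := fun (h : E) _ => Measurable (h : Y → ℝ))
    ?_ ?_ ?_ ?_ (hg n)
  · rintro _ ⟨x, v, rfl⟩
    have e : RKHS.kerFun E x v = v • kfun E x := by
      rw [kfun, ← map_smul, smul_eq_mul, mul_one]
    rw [e, RKHS.coe_smul]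
    exact (hK.comp measurable_prodMk_left).const_smul v
  · rw [RKHS.coe_zero]
    exact measurable_zero
  · intro a b _ _ ha hb
    rw [RKHS.coe_add]
    exact ha.add hb
  · intro c a _ ha
    rw [RKHS.coe_smul]
    exact ha.const_smul c

variable {Ω : Type*} [MeasurableSpace Ω] {P : Measure Ω} [IsProbabilityMeasure P]

theorem integrable_apply (hK : Measurable fun p : Y × Y => kval E p.1 p.2) {B : ℝ}
    (hB : ∀ x, ‖kfun E x‖ ≤ B) {X : Ω → Y} (hX : AEMeasurable X P) (f : E) :
    Integrable (fun ω => f (X ω)) P :=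
  .of_bound ((measurable_of_kernel hK f).comp_aemeasurable hX).aestronglyMeasurable (B * ‖f‖)
    (ae_of_all _ fun _ => abs_apply_le hB f _)

/-- The mean embedding exists for a bounded measurable kernel. -/
theorem isMean_mean_kfun (hK : Measurable fun p : Y × Y => kval E p.1 p.2) {B : ℝ}
    (hB : ∀ x, ‖kfun E x‖ ≤ B) {X : Ω → Y} (hX : AEMeasurable X P) :
    IsMean P (fun ω => kfun E (X ω)) (mean P fun ω => kfun E (X ω)) := by
  have hi := integrable_apply (P := P) hK hB hX
  -- The Riesz representative of the bounded functional `f ↦ E f(X)` is a weak mean.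
  let φ : E →L[ℝ] ℝ := LinearMap.mkContinuous
    { toFun := fun f => ∫ ω, f (X ω) ∂P
      map_add' := fun f g => by
        simp only [RKHS.coe_add, Pi.add_apply]
        exact integral_add (hi f) (hi g)
      map_smul' := fun c f => by
        simp only [RKHS.coe_smul, Pi.smul_apply, RingHom.id_apply]
        exact integral_smul c _ } B fun f => by
      have := norm_integral_le_of_norm_le_const (μ := P) (f := fun ω => f (X ω)) (C := B * ‖f‖)
        (ae_of_all _ fun _ => abs_apply_le hB f _)
      simpa using this
  refine Classical.epsilon_spec (p := IsMean P fun ω => kfun E (X ω))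
    ⟨(InnerProductSpace.toDual ℝ E).symm φ, fun f => ?_⟩
  simp only [inner_kfun]
  refine ⟨hi f, ?_⟩
  rw [InnerProductSpace.toDual_symm_apply]
  rfl

theorem measurable_inner_kfun_sub (hK : Measurable fun p : Y × Y => kval E p.1 p.2) (m : E) :
    Measurable fun p : Y × Y => ⟪kfun E p.1 - m, kfun E p.2 - m⟫_ℝ := by
  have h := measurable_of_kernel hK m
  simp only [inner_kfun_sub_kfun_sub]
  exact ((hK.sub (h.comp measurable_fst)).sub (h.comp measurable_snd)).add_const _

/-- Fubini: for fixed `x`, the mean of `⟪k_x - m, k_T - m⟫` over `T` is zero because `m` is the weak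
mean of `k_T`. -/
theorem integral_inner_kfun_sub_eq_zero (hK : Measurable fun p : Y × Y => kval E p.1 p.2) {B : ℝ}
    (hB : ∀ x, ‖kfun E x‖ ≤ B) {X S T : Ω → Y} {m : E}
    (hm : IsMean P (fun ω => kfun E (X ω)) m) (hS : IdentDistrib S X P P)
    (hT : IdentDistrib T X P P) (hST : S ⟂ᵢ[P] T) :
    ∫ ω, ⟪kfun E (S ω) - m, kfun E (T ω) - m⟫_ℝ ∂P = 0 := by
  have hlaw := (indepFun_iff_map_prod_eq_prod_map_map hS.aemeasurable_fst
    hT.aemeasurable_fst).1 hST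
  have hmeas := measurable_inner_kfun_sub hK m
  have h1 := integral_map (μ := P) (hS.aemeasurable_fst.prodMk hT.aemeasurable_fst)
    hmeas.aestronglyMeasurable
  have : IsProbabilityMeasure (P.map S) := Measure.isProbabilityMeasure_map hS.aemeasurable_fst
  have : IsProbabilityMeasure (P.map T) := Measure.isProbabilityMeasure_map hT.aemeasurable_fst
  rw [← h1, hlaw, integral_prod _ (.of_bound hmeas.aestronglyMeasurable ((2 * B) ^ 2)
    (ae_of_all _ fun p => abs_inner_kfun_sub_le hB (norm_mean_le hm hB) _ _))]
  refine integral_eq_zero_of_ae (ae_of_all _ fun x => ?_)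
  have hf : Measurable ((kfun E x - m : E) : Y → ℝ) := measurable_of_kernel hK _
  have e : ∀ y, ⟪kfun E x - m, kfun E y - m⟫_ℝ = (kfun E x - m) y - ⟪m, kfun E x - m⟫_ℝ :=
    fun y => by rw [← inner_kfun, inner_sub_right, real_inner_comm, real_inner_comm m]
  simp only [e, Pi.zero_apply]
  rw [hT.map_eq, integral_sub _ (integrable_const _), integral_map hT.aemeasurable_snd
    hf.aestronglyMeasurable, integral_apply_eq hm]
  · have : IsProbabilityMeasure (P.map X) := Measure.isProbabilityMeasure_map hT.aemeasurable_snd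
    simp
  · exact (integrable_map_measure hf.aestronglyMeasurable hT.aemeasurable_snd).2
      (integrable_apply hK hB hT.aemeasurable_snd _)

theorem integrable_norm_centredAvg_sq (hK : Measurable fun p : Y × Y => kval E p.1 p.2) {B : ℝ}
    (hB : ∀ x, ‖kfun E x‖ ≤ B) {m : E} (hmB : ‖m‖ ≤ B) {n : ℕ} (a : Fin n → ℝ)
    {S : Fin n → Ω → Y} (hS : ∀ i, AEMeasurable (S i) P) :
    Integrable (fun ω => ‖centredAvg m a fun i => S i ω‖ ^ 2) P := by
  simp only [norm_centredAvg_sq]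
  refine (integrable_finsetSum _ fun i _ => integrable_finsetSum _ fun j _ =>
    Integrable.const_mul ?_ _).const_mul _
  exact .of_bound ((measurable_inner_kfun_sub hK m).comp_aemeasurable
    ((hS i).prodMk (hS j))).aestronglyMeasurable ((2 * B) ^ 2)
    (ae_of_all _ fun ω => abs_inner_kfun_sub_le hB hmB _ _)

/-- In the double sum for the squared norm the off-diagonal terms have mean zero, leaving `n`
diagonal terms, each at most `(2 B C)²`, against the factor `1/n²`. -/
theorem integral_norm_centredAvg_sq_le (hK : Measurable fun p : Y × Y => kval E p.1 p.2) {B : ℝ}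
    (hB : ∀ x, ‖kfun E x‖ ≤ B) {X : Ω → Y} {m : E}
    (hm : IsMean P (fun ω => kfun E (X ω)) m) {n : ℕ} {a : Fin n → ℝ} {C : ℝ}
    (ha : ∀ i, |a i| ≤ C) {S : Fin n → Ω → Y} (hindep : iIndepFun S P)
    (hS : ∀ i, IdentDistrib (S i) X P P) :
    ∫ ω, ‖centredAvg m a fun i => S i ω‖ ^ 2 ∂P ≤ (2 * B * C) ^ 2 / n := by
  have hmB := norm_mean_le hm hB
  have hint : ∀ i j, Integrable
      (fun ω => a i * a j * ⟪kfun E (S i ω) - m, kfun E (S j ω) - m⟫_ℝ) P := fun i j =>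
    Integrable.const_mul (.of_bound ((measurable_inner_kfun_sub hK m).comp_aemeasurable
      ((hS i).aemeasurable_fst.prodMk (hS j).aemeasurable_fst)).aestronglyMeasurable ((2 * B) ^ 2)
      (ae_of_all _ fun ω => abs_inner_kfun_sub_le hB hmB _ _)) _
  simp only [norm_centredAvg_sq]
  rw [integral_const_mul, integral_finsetSum _ fun i _ => integrable_finsetSum _ fun j _ => hint i j]
  have hsum : ∀ i, ∫ ω, ∑ j, a i * a j * ⟪kfun E (S i ω) - m, kfun E (S j ω) - m⟫_ℝ ∂P
      ≤ (2 * B * C) ^ 2 := by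
    intro i
    rw [integral_finsetSum _ fun j _ => hint i j, Finset.sum_eq_single i]
    · refine (Real.le_norm_self _).trans ((norm_integral_le_of_norm_le_const
        (μ := P) (C := (2 * B * C) ^ 2) (ae_of_all _ fun ω => ?_)).trans_eq (by rw [probReal_univ, mul_one]))
      have h1 := abs_inner_kfun_sub_le hB hmB (S i ω) (S i ω)
      have h2 := ha i
      rw [Real.norm_eq_abs, abs_mul, abs_mul]
      calc _ ≤ C * C * (2 * B) ^ 2 :=
            mul_le_mul (mul_le_mul h2 h2 (abs_nonneg _) ((abs_nonneg _).trans h2)) h1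
              (abs_nonneg _) (mul_self_nonneg _)
        _ = _ := by ring
    · intro j _ hj
      rw [integral_const_mul, integral_inner_kfun_sub_eq_zero hK hB hm (hS i) (hS j)
        (hindep.indepFun hj.symm), mul_zero]
    · exact fun h => absurd (Finset.mem_univ i) h
  -- For `n = 0` both sides are `0`, by division by zero.
  rcases Nat.eq_zero_or_pos n with rfl | hn
  · simp
  · calc _ ≤ (1 / (n : ℝ)) ^ 2 * ∑ _i : Fin n, (2 * B * C) ^ 2 := by
          gcongr with i
          exact hsum i
      _ = _ := by
          rw [Finset.sum_const, Finset.card_univ, Fintype.card_fin, nsmul_eq_mul]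
          field_simp

end RKHSMean

/-! ### Expansion of elementary tensors -/

section TensorExpansion

variable {ι : Type*} [Fintype ι] {H : ι → Type*}
  [∀ l, NormedAddCommGroup (H l)] [∀ l, InnerProductSpace ℝ (H l)]

theorem norm_tprod (f : ∀ l, H l) : ‖tprod f‖ = ∏ l, ‖f l‖ := by
  refine (sq_eq_sq₀ (norm_nonneg _) (Finset.prod_nonneg fun _ _ => norm_nonneg _)).1 ?_
  rw [← real_inner_self_eq_norm_sq, inner_tprod, ← Finset.prod_pow]
  simp only [real_inner_self_eq_norm_sq]

theorem norm_tprod_le {f : ∀ l, H l} {B : ℝ} (hf : ∀ l, ‖f l‖ ≤ B) :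
    ‖tprod f‖ ≤ B ^ Fintype.card ι := by
  rw [norm_tprod]
  refine (Finset.prod_le_prod (fun _ _ => norm_nonneg _) fun l _ => hf l).trans ?_
  simp

variable [DecidableEq ι]

theorem tprod_update_sub (f : ∀ l, H l) (a : ι) (u v : H a) :
    tprod (Function.update f a (u - v))
      = tprod (Function.update f a u) - tprod (Function.update f a v) :=
  map_sub (tprodSlot f a) u v

/-- Replace the factors in `s` one at a time. Each slot has its own bound `b l`, so that the second
order estimate can apply this with a small vector in one slot. -/
theorem norm_tprod_piecewise_sub_le {f g : ∀ l, H l} {b : ι → ℝ} (s : Finset ι)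
    (hf : ∀ l ∈ s, ‖f l‖ ≤ b l) (hg : ∀ l, ‖g l‖ ≤ b l) :
    ‖tprod (s.piecewise f g) - tprod g‖
      ≤ ∑ l ∈ s, ‖f l - g l‖ * ∏ k ∈ Finset.univ.erase l, b k := by
  induction s using Finset.induction_on with
  | empty => simp
  | insert a s ha ih =>
    have ih := ih fun l hl => hf l (Finset.mem_insert_of_mem hl)
    set h := s.piecewise f g with hh
    have hha : h a = g a := Finset.piecewise_eq_of_notMem _ _ _ ha
    have hle : ∀ l, ‖h l‖ ≤ b l := fun l => by
      by_cases hl : l ∈ s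
      · rw [hh, Finset.piecewise_eq_of_mem _ _ _ hl]
        exact hf l (Finset.mem_insert_of_mem hl)
      · rw [hh, Finset.piecewise_eq_of_notMem _ _ _ hl]
        exact hg l
    have e : tprod ((insert a s).piecewise f g) - tprod g
        = tprod (Function.update h a (f a - g a)) + (tprod h - tprod g) := by
      rw [Finset.piecewise_insert, tprod_update_sub, ← hha, Function.update_eq_self]
      abel
    rw [e, Finset.sum_insert ha]
    refine (norm_add_le _ _).trans (add_le_add ?_ ih)
    rw [norm_tprod, ← Finset.mul_prod_erase _ _ (Finset.mem_univ a), Function.update_self]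
    refine mul_le_mul_of_nonneg_left (Finset.prod_le_prod (fun _ _ => norm_nonneg _)
      fun l hl => ?_) (norm_nonneg _)
    rw [Function.update_of_ne (Finset.ne_of_mem_erase hl)]
    exact hle l

theorem norm_tprod_sub_le {f g : ∀ l, H l} {B : ℝ} (hB : 1 ≤ B) (hf : ∀ l, ‖f l‖ ≤ B)
    (hg : ∀ l, ‖g l‖ ≤ B) :
    ‖tprod f - tprod g‖ ≤ B ^ Fintype.card ι * ∑ l, ‖f l - g l‖ := by
  have h := norm_tprod_piecewise_sub_le (b := fun _ => B) Finset.univ (fun l _ => hf l) hg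
  rw [Finset.piecewise_univ] at h
  refine h.trans ?_
  rw [mul_comm, Finset.sum_mul]
  gcongr with l
  rw [Finset.prod_const]
  exact pow_le_pow_right₀ hB (Finset.card_le_univ _)

/-- The second order expansion of the elementary tensor. -/
theorem norm_tprod_piecewise_sub_sub_le {f g : ∀ l, H l} {B : ℝ} (hB : 1 ≤ B)
    (hf : ∀ l, ‖f l‖ ≤ B) (hg : ∀ l, ‖g l‖ ≤ B) (s : Finset ι) :
    ‖tprod (s.piecewise f g) - tprod g - ∑ l ∈ s, tprod (Function.update g l (f l - g l))‖
      ≤ B ^ Fintype.card ι * (∑ l ∈ s, ‖f l - g l‖) ^ 2 := by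
  induction s using Finset.induction_on with
  | empty => simp
  | insert a s ha ih =>
    set h := s.piecewise f g with hh
    have hha : h a = g a := Finset.piecewise_eq_of_notMem _ _ _ ha
    -- The increment in slot `a` is taken at the partly replaced tensor `h`, the linear term at `g`.
    -- Their difference is a first order difference over `s` with `f a - g a` fixed in slot `a`,
    -- hence a product of two increments.
    have e : tprod ((insert a s).piecewise f g) - tprod g
          - ∑ l ∈ insert a s, tprod (Function.update g l (f l - g l))
        = (tprod (Function.update h a (f a - g a)) - tprod (Function.update g a (f a - g a)))
          + (tprod h - tprod g - ∑ l ∈ s, tprod (Function.update g l (f l - g l))) := by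
      rw [Finset.piecewise_insert, Finset.sum_insert ha, tprod_update_sub h, ← hha,
        Function.update_eq_self]
      abel
    have e2 : Function.update h a (f a - g a)
        = s.piecewise f (Function.update g a (f a - g a)) := by
      ext l
      by_cases hl : l = a
      · subst hl
        rw [Finset.piecewise_eq_of_notMem _ _ _ ha, Function.update_self, Function.update_self]
      · rw [Function.update_of_ne hl]
        by_cases hs : l ∈ s
        · rw [hh, Finset.piecewise_eq_of_mem _ _ _ hs, Finset.piecewise_eq_of_mem _ _ _ hs]
        · rw [hh, Finset.piecewise_eq_of_notMem _ _ _ hs, Finset.piecewise_eq_of_notMem _ _ _ hs,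
            Function.update_of_ne hl]
    have h1 := norm_tprod_piecewise_sub_le (f := f) (g := Function.update g a (f a - g a))
      (b := Function.update (fun _ => B) a ‖f a - g a‖) s
      (fun l hl => by
        rw [Function.update_of_ne (ne_of_mem_of_not_mem hl ha)]
        exact hf l)
      (fun l => by
        by_cases hl : l = a
        · subst hl
          simp
        · rw [Function.update_of_ne hl, Function.update_of_ne hl]
          exact hg l)
    have h2 : ∀ l ∈ s, ‖f l - Function.update g a (f a - g a) l‖
          * ∏ k ∈ Finset.univ.erase l, Function.update (fun _ => B) a ‖f a - g a‖ k
        ≤ ‖f l - g l‖ * (‖f a - g a‖ * B ^ Fintype.card ι) := by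
      intro l hl
      have hla : l ≠ a := ne_of_mem_of_not_mem hl ha
      rw [Function.update_of_ne hla, ← Finset.mul_prod_erase (Finset.univ.erase l) _
        (Finset.mem_erase.2 ⟨hla.symm, Finset.mem_univ a⟩), Function.update_self,
        Finset.prod_congr rfl (g := fun _ => B) fun k hk =>
          Function.update_of_ne (Finset.ne_of_mem_erase hk) _ _, Finset.prod_const]
      gcongr
      exact Finset.card_le_univ _
    rw [e, e2, Finset.sum_insert ha]
    refine (norm_add_le _ _).trans ((add_le_add (h1.trans (Finset.sum_le_sum h2)) ih).trans ?_)
    rw [← Finset.sum_mul]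
    have hS : 0 ≤ ∑ l ∈ s, ‖f l - g l‖ := Finset.sum_nonneg fun _ _ => norm_nonneg _
    have hb : 0 ≤ B ^ Fintype.card ι := by positivity
    have hd := norm_nonneg (f a - g a)
    -- With `S` the sum over `s` and `δ` the new increment, this is `S δ + S² ≤ (δ + S)²`.
    nlinarith [mul_nonneg hb (sq_nonneg ‖f a - g a‖), mul_nonneg hb (mul_nonneg hS hd)]

theorem norm_tprod_sub_sub_le {f g : ∀ l, H l} {B : ℝ} (hB : 1 ≤ B)
    (hf : ∀ l, ‖f l‖ ≤ B) (hg : ∀ l, ‖g l‖ ≤ B) :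
    ‖tprod f - tprod g - ∑ l, tprod (Function.update g l (f l - g l))‖
      ≤ B ^ Fintype.card ι * (∑ l, ‖f l - g l‖) ^ 2 := by
  have h := norm_tprod_piecewise_sub_sub_le hB hf hg Finset.univ
  rwa [Finset.piecewise_univ] at h

end TensorExpansion

/-! ### Linearization of the estimator -/

section Linearization

variable {E Y : Type*} [NormedAddCommGroup E] [InnerProductSpace ℝ E] [CompleteSpace E]
  [RKHS ℝ E Y ℝ]

/-- The weighted average of the kernel functions at the observations. -/
noncomputable def kernelAvg (E : Type*) {Y : Type*} [NormedAddCommGroup E]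
    [InnerProductSpace ℝ E] [CompleteSpace E] [RKHS ℝ E Y ℝ] {n : ℕ} (a : Fin n → ℝ)
    (x : Fin n → Y) : E :=
  (1 / (n : ℝ)) • ∑ i, a i • kfun E (x i)

/-- The mean weight need not equal `1`; the coefficient of `m` is what later produces the bias term.
-/
theorem kernelAvg_eq {n : ℕ} (m : E) (a : Fin n → ℝ) (x : Fin n → Y) :
    kernelAvg E a x = centredAvg m a x + (1 / (n : ℝ) * ∑ i, a i) • m := by
  simp only [kernelAvg, centredAvg, smul_sub, Finset.sum_sub_distrib, ← Finset.sum_smul, mul_smul]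
  abel

theorem kernelAvg_one_eq {n : ℕ} (hn : 0 < n) (m : E) (x : Fin n → Y) :
    kernelAvg E (fun _ => 1) x = centredAvg m (fun _ => 1) x + m := by
  rw [kernelAvg_eq m]
  have : (n : ℝ) ≠ 0 := by positivity
  simp [this]

theorem norm_kernelAvg_one_le {B : ℝ} (hB : ∀ x, ‖kfun E x‖ ≤ B) {n : ℕ} (hn : 0 < n)
    (x : Fin n → Y) : ‖kernelAvg E (fun _ => 1) x‖ ≤ B := by
  have hn' : (0 : ℝ) < n := by positivity
  rw [kernelAvg, norm_smul, Real.norm_of_nonneg (by positivity)]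
  calc _ ≤ 1 / (n : ℝ) * ∑ _i : Fin n, B := by
        gcongr
        refine (norm_sum_le _ _).trans (Finset.sum_le_sum fun i _ => ?_)
        rw [one_smul]
        exact hB _
    _ = B := by
        rw [Finset.sum_const, Finset.card_univ, Fintype.card_fin, nsmul_eq_mul]
        field_simp

theorem inner_kernelAvg {n : ℕ} (a : Fin n → ℝ) (x : Fin n → Y) (f : E) :
    ⟪kernelAvg E a x, f⟫_ℝ = 1 / (n : ℝ) * ∑ i, a i * f (x i) := by
  rw [kernelAvg, real_inner_smul_left, sum_inner]
  simp only [real_inner_smul_left, inner_kfun]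

theorem inner_centredAvg {n : ℕ} (m : E) (a : Fin n → ℝ) (x : Fin n → Y) (f : E) :
    ⟪centredAvg m a x, f⟫_ℝ = 1 / (n : ℝ) * ∑ i, a i * ⟪kfun E (x i) - m, f⟫_ℝ := by
  rw [centredAvg, real_inner_smul_left, sum_inner]
  simp only [real_inner_smul_left]

theorem kernelAvg_apply {n : ℕ} (a : Fin n → ℝ) (x : Fin n → Y) (y : Y) :
    kernelAvg E a x y = 1 / (n : ℝ) * ∑ i, a i * kval E y (x i) := by
  rw [← inner_kfun, real_inner_comm, inner_kernelAvg]
  simp only [← inner_kfun_kfun y, ← inner_kfun]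
  simp only [real_inner_comm]

variable {d : ℕ} {𝒳 : Fin d → Type*} (H : Fin d → Type*)
  [∀ l, NormedAddCommGroup (H l)] [∀ l, InnerProductSpace ℝ (H l)] [∀ l, CompleteSpace (H l)]
  [∀ l, RKHS ℝ (H l) (𝒳 l) ℝ]

/-- The estimator in terms of averages of kernel functions. -/
theorem estimator_eq {n : ℕ} (w : Fin n → ℝ) (x : Fin n → ∀ l, 𝒳 l) :
    estimator H w x = ‖kernelAvg (TensorHilbert H) (fun _ => 1) x‖ ^ 2
      + ‖tprod fun l => kernelAvg (H l) (fun _ => 1) fun i => x i l‖ ^ 2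
      - 2 * ⟪kernelAvg (TensorHilbert H) w x,
          tprod fun l => kernelAvg (H l) (fun _ => 1) fun i => x i l⟫_ℝ := by
  rw [estimator, norm_tprod, ← Finset.prod_pow, ← real_inner_self_eq_norm_sq]
  simp only [← real_inner_self_eq_norm_sq, inner_kernelAvg, kernelAvg_apply, tprod_apply,
    kval_tensor, one_mul, Finset.prod_mul_distrib, Finset.prod_const, Finset.card_univ,
    Fintype.card_fin, ← Finset.mul_sum]
  have e : ∀ i, w i * ((1 / (n : ℝ)) ^ d * ∏ l, ∑ j, kval (H l) (x i l) (x j l))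
      = (1 / (n : ℝ)) ^ d * (w i * ∏ l, ∑ j, kval (H l) (x i l) (x j l)) := fun i => by ring
  simp only [e, ← Finset.mul_sum]
  ring

end Linearization

/-! ### Linear part and quadratic remainder of the estimator -/

section LinearPart

variable {d : ℕ} {𝒳 : Fin d → Type*} (H : Fin d → Type*)
  [∀ l, NormedAddCommGroup (H l)] [∀ l, InnerProductSpace ℝ (H l)] [∀ l, CompleteSpace (H l)]
  [∀ l, RKHS ℝ (H l) (𝒳 l) ℝ]
  {Ω : Type*} [MeasurableSpace Ω] (P : Measure Ω) (X : Ω → ∀ l, 𝒳 l)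

theorem tprod_update_centredAvg (g : ∀ l, H l) (l : Fin d) {n : ℕ} (x : Fin n → ∀ l, 𝒳 l) :
    tprod (Function.update g l (centredAvg (g l) (fun _ => 1) fun i => x i l))
      = (1 / (n : ℝ)) • ∑ i, (tprod (Function.update g l (kfun (H l) (x i l))) - tprod g) := by
  rw [← tprodSlot_apply, centredAvg, map_smul, map_sum]
  congr 1
  refine Finset.sum_congr rfl fun i _ => ?_
  rw [one_smul, map_sub, tprodSlot_apply, tprodSlot_apply, Function.update_eq_self]

/-- Averaging passes through the inner products and through each slot of the tensor. The term `d ν`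
in `U` is `ν` subtracted once per slot. -/
theorem sum_U_sub_V {n : ℕ} (w : Fin n → ℝ) (x : Fin n → ∀ l, 𝒳 l) :
    1 / (n : ℝ) * ∑ i, (U H P X (x i) - w i * V H P X (x i))
      = ⟪centredAvg (jointMean H P X) (fun _ => 1) x, jointMean H P X⟫_ℝ
        + ⟪∑ l, tprod (Function.update (margMean H P X) l
            (centredAvg (margMean H P X l) (fun _ => 1) fun i => x i l)),
          prodMean H P X - jointMean H P X⟫_ℝ
        - ⟪centredAvg (jointMean H P X) w x, prodMean H P X⟫_ℝ := by
  simp only [tprod_update_centredAvg, ← Finset.smul_sum, inner_centredAvg]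
  rw [Finset.sum_comm, real_inner_smul_left, sum_inner, ← mul_add, ← mul_sub,
    ← Finset.sum_add_distrib, ← Finset.sum_sub_distrib]
  congr 1
  refine Finset.sum_congr rfl fun i _ => ?_
  rw [U, V, Finset.sum_sub_distrib, Finset.sum_const, Finset.card_univ, Fintype.card_fin,
    ← Nat.cast_smul_eq_nsmul ℝ, prodMean]
  ring

/-- The estimator is the average of the variables `2 (U - w V)` up to quadratic terms. -/
theorem abs_estimator_sub_linear_le {B : ℝ} (hB : 1 ≤ B) (hk : ∀ l y, ‖kfun (H l) y‖ ≤ B)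
    (hm : ∀ l, ‖margMean H P X l‖ ≤ B) (hj : ‖jointMean H P X‖ ≤ B ^ d) {n : ℕ} (hn : 0 < n)
    (w : Fin n → ℝ) (x : Fin n → ∀ l, 𝒳 l) :
    |estimator H w x - dHSIC H P X - 2 * (1 / (n : ℝ) * ∑ i, (U H P X (x i) - w i * V H P X (x i)))|
      ≤ ‖centredAvg (jointMean H P X) (fun _ => 1) x‖ ^ 2
        + ‖centredAvg (jointMean H P X) w x‖ ^ 2
        + 6 * (B ^ d) ^ 2 * d *
          ∑ l, ‖centredAvg (margMean H P X l) (fun _ => 1) fun i => x i l‖ ^ 2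
        + 2 * (B ^ d) ^ 2 * |1 / (n : ℝ) * ∑ i, w i - 1| := by
  rw [estimator_eq, sum_U_sub_V, kernelAvg_one_eq hn (jointMean H P X),
    kernelAvg_eq (jointMean H P X) w, dHSIC]
  set D := centredAvg (jointMean H P X) (fun _ => 1) x with hD
  set G := centredAvg (jointMean H P X) w x with hG
  set m := jointMean H P X with hmdef
  set ν := prodMean H P X with hν
  set N : TensorHilbert H := tprod fun l => kernelAvg (H l) (fun _ => 1) fun i => x i l with hN
  set c := 1 / (n : ℝ) * ∑ i, w i with hc
  have hδ : ∀ l, kernelAvg (H l) (fun _ => 1) (fun i => x i l) - margMean H P X l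
      = centredAvg (margMean H P X l) (fun _ => 1) fun i => x i l := fun l => by
    rw [kernelAvg_one_eq hn (margMean H P X l), add_sub_cancel_right]
  have hav : ∀ l, ‖kernelAvg (H l) (fun _ => 1) fun i => x i l‖ ≤ B := fun l =>
    norm_kernelAvg_one_le (hk l) hn _
  have h1 := norm_tprod_sub_le hB hav hm
  have h2 := norm_tprod_sub_sub_le hB hav hm
  have hNle := norm_tprod_le hav
  have hνle := norm_tprod_le hm
  simp only [hδ, Fintype.card_fin] at h1 h2 hNle hνle
  set e : Fin d → ℝ := fun l => ‖centredAvg (margMean H P X l) (fun _ => 1) fun i => x i l‖ with he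
  set L := ∑ l, tprod (Function.update (margMean H P X) l
            (centredAvg (margMean H P X l) (fun _ => 1) fun i => x i l)) with hL
  -- Cauchy–Schwarz, since moments are available for the individual squares; this is the factor `d`
  -- in the bound.
  have hs : (∑ l, e l) ^ 2 ≤ d * ∑ l, e l ^ 2 := by
    simpa using sq_sum_le_card_mul_sum_sq (s := (Finset.univ : Finset (Fin d))) (f := e)
  change ‖N - ν‖ ≤ B ^ d * ∑ l, e l at h1
  change ‖N - ν - L‖ ≤ B ^ d * (∑ l, e l) ^ 2 at h2
  change ‖N‖ ≤ B ^ d at hNle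
  change ‖ν‖ ≤ B ^ d at hνle
  change _ ≤ ‖D‖ ^ 2 + ‖G‖ ^ 2 + 6 * (B ^ d) ^ 2 * d * ∑ l, e l ^ 2 + 2 * (B ^ d) ^ 2 * |c - 1|
  set b := B ^ d with hb
  have hb0 : 0 ≤ b := by positivity
  set s := ∑ l, e l with hsdef
  set R := N - ν - L with hR
  have eN : N = ν + L + R := by rw [hR]; abel
  -- Exact identity: the first order terms cancel, and what remains is quadratic in the deviations
  -- or carries the factor `c - 1`.
  have key : ‖D + m‖ ^ 2 + ‖N‖ ^ 2 - 2 * ⟪G + c • m, N⟫_ℝ - ‖m - ν‖ ^ 2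
        - 2 * (⟪D, m⟫_ℝ + ⟪L, ν - m⟫_ℝ - ⟪G, ν⟫_ℝ)
      = ‖D‖ ^ 2 + ‖N - ν‖ ^ 2 + 2 * ⟪R, ν⟫_ℝ - 2 * ⟪R, m⟫_ℝ - 2 * ⟪G, N - ν⟫_ℝ
        - 2 * ((c - 1) * ⟪m, N⟫_ℝ) := by
    have eR : ∀ z, ⟪R, z⟫_ℝ = ⟪N, z⟫_ℝ - ⟪ν, z⟫_ℝ - ⟪L, z⟫_ℝ := fun z => by
      rw [hR, inner_sub_left, inner_sub_left]
    rw [norm_add_sq_real, norm_sub_sq_real, norm_sub_sq_real, eR, eR, inner_sub_right,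
      inner_sub_right, inner_add_left, real_inner_smul_left, real_inner_self_eq_norm_sq,
      real_inner_comm m N, real_inner_comm m ν]
    ring
  rw [key]
  have i1 := abs_real_inner_le_norm R ν
  have i2 := abs_real_inner_le_norm R m
  have i3 := abs_real_inner_le_norm G (N - ν)
  have i4 := abs_real_inner_le_norm m N
  -- The constant `6` counts multiples of `b² s²`: one from `‖N - ν‖²`, two from each of the inner
  -- products with `R`, and one from the inner product with `G`.
  have j1 : |⟪R, ν⟫_ℝ| ≤ b ^ 2 * s ^ 2 := i1.trans <| by
    calc _ ≤ (b * s ^ 2) * b := mul_le_mul h2 hνle (norm_nonneg _) (by positivity)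
      _ = _ := by ring
  have j2 : |⟪R, m⟫_ℝ| ≤ b ^ 2 * s ^ 2 := i2.trans <| by
    calc _ ≤ (b * s ^ 2) * b := mul_le_mul h2 hj (norm_nonneg _) (by positivity)
      _ = _ := by ring
  have j0 : ‖N - ν‖ ^ 2 ≤ b ^ 2 * s ^ 2 := by
    rw [← mul_pow]
    exact pow_le_pow_left₀ (norm_nonneg _) h1 2
  have j3 : 2 * |⟪G, N - ν⟫_ℝ| ≤ ‖G‖ ^ 2 + b ^ 2 * s ^ 2 := by
    nlinarith [sq_nonneg (‖G‖ - ‖N - ν‖)]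
  have j4 : |(c - 1) * ⟪m, N⟫_ℝ| ≤ |c - 1| * b ^ 2 := by
    rw [abs_mul, sq]
    exact mul_le_mul_of_nonneg_left (i4.trans (mul_le_mul hj hNle (norm_nonneg _) hb0))
      (abs_nonneg _)
  have j5 : b ^ 2 * s ^ 2 ≤ b ^ 2 * (d * ∑ l, e l ^ 2) := by gcongr
  have j6 : 0 ≤ ‖N - ν‖ ^ 2 := by positivity
  have j7 : 0 ≤ ‖D‖ ^ 2 := by positivity
  rw [abs_le] at j1 j2 j4 ⊢
  have j8 := abs_le.1 (le_refl |⟪G, N - ν⟫_ℝ|)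
  constructor <;> linarith

end LinearPart

/-! ### Moments of the linear part -/

section Moments

variable {d : ℕ} {𝒳 : Fin d → Type*} [∀ l, MeasurableSpace (𝒳 l)] {H : Fin d → Type*}
  [∀ l, NormedAddCommGroup (H l)] [∀ l, InnerProductSpace ℝ (H l)] [∀ l, CompleteSpace (H l)]
  [∀ l, RKHS ℝ (H l) (𝒳 l) ℝ]

theorem measurable_kval_tensor
    (hK : ∀ l, Measurable fun p : 𝒳 l × 𝒳 l => kval (H l) p.1 p.2) :
    Measurable fun p : (∀ l, 𝒳 l) × (∀ l, 𝒳 l) => kval (TensorHilbert H) p.1 p.2 := by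
  simp only [kval_tensor]
  have h : ∀ l, Measurable fun p : (∀ l, 𝒳 l) × (∀ l, 𝒳 l) => kval (H l) (p.1 l) (p.2 l) := by
    intro l
    have hl : Measurable fun p : (∀ l, 𝒳 l) × (∀ l, 𝒳 l) => (p.1 l, p.2 l) := by fun_prop
    have hc := (hK l).comp hl
    exact hc
  exact Finset.measurable_fun_prod _ fun l _ => h l

omit [∀ l, MeasurableSpace (𝒳 l)] in
theorem norm_kfun_tensor_le {B : ℝ} (hk : ∀ l y, ‖kfun (H l) y‖ ≤ B) (x : ∀ l, 𝒳 l) :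
    ‖kfun (TensorHilbert H) x‖ ≤ B ^ d := by
  rw [kfun_tensor]
  simpa using norm_tprod_le fun l => hk l (x l)

variable {Ω : Type*} [MeasurableSpace Ω] {P : Measure Ω} {X : Ω → ∀ l, 𝒳 l}

-- Through the adjoint of the slot map, each summand of `U` becomes the value at `x l` of one
-- element of `H l`, so measurability, bounds and means follow from those of single functions.
omit [∀ l, MeasurableSpace (𝒳 l)] in
theorem U_eq (x : ∀ l, 𝒳 l) :
    U H P X x = ∑ l, (tprodSlot (margMean H P X) l).adjoint (prodMean H P X - jointMean H P X) (x l)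
      - d * ⟪prodMean H P X, prodMean H P X - jointMean H P X⟫_ℝ
      + (jointMean H P X x - ‖jointMean H P X‖ ^ 2) := by
  rw [U, inner_sub_left, sum_inner, real_inner_smul_left, inner_sub_left (kfun _ _), inner_kfun,
    real_inner_self_eq_norm_sq]
  congr 2
  refine Finset.sum_congr rfl fun l _ => ?_
  rw [← inner_kfun, ContinuousLinearMap.adjoint_inner_right, tprodSlot_apply]

omit [∀ l, MeasurableSpace (𝒳 l)] in
theorem V_eq (x : ∀ l, 𝒳 l) :
    V H P X x = prodMean H P X x - ⟪jointMean H P X, prodMean H P X⟫_ℝ := by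
  rw [V, inner_sub_left, inner_kfun]

theorem measurable_U (hK : ∀ l, Measurable fun p : 𝒳 l × 𝒳 l => kval (H l) p.1 p.2) :
    Measurable (U H P X) := by
  rw [funext (U_eq (H := H) (P := P) (X := X))]
  have h1 : ∀ l, Measurable fun x : ∀ l, 𝒳 l => (tprodSlot (margMean H P X) l).adjoint
      (prodMean H P X - jointMean H P X) (x l) := fun l =>
    (measurable_of_kernel (hK l) _).comp (measurable_pi_apply l)
  have h2 := measurable_of_kernel (measurable_kval_tensor hK) (jointMean H P X)
  have h3 : Measurable fun x : ∀ l, 𝒳 l => ∑ l, (tprodSlot (margMean H P X) l).adjoint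
      (prodMean H P X - jointMean H P X) (x l) :=
    Finset.measurable_fun_sum _ fun l _ => h1 l
  exact (h3.sub_const _).add (h2.sub_const _)

theorem measurable_V (hK : ∀ l, Measurable fun p : 𝒳 l × 𝒳 l => kval (H l) p.1 p.2) :
    Measurable (V H P X) := by
  rw [funext (V_eq (H := H) (P := P) (X := X))]
  exact (measurable_of_kernel (measurable_kval_tensor hK) _).sub_const _

omit [∀ l, MeasurableSpace (𝒳 l)] in
theorem exists_abs_U_le {B : ℝ} (hk : ∀ l y, ‖kfun (H l) y‖ ≤ B) :
    ∃ C, ∀ x, |U H P X x| ≤ C := by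
  refine ⟨∑ l, B * ‖(tprodSlot (margMean H P X) l).adjoint (prodMean H P X - jointMean H P X)‖
      + |d * ⟪prodMean H P X, prodMean H P X - jointMean H P X⟫_ℝ|
      + (B ^ d * ‖jointMean H P X‖ + |‖jointMean H P X‖ ^ 2|), fun x => ?_⟩
  rw [U_eq]
  refine (abs_add_le _ _).trans (add_le_add ((abs_sub _ _).trans (add_le_add
    ((Finset.abs_sum_le_sum_abs _ _).trans (Finset.sum_le_sum fun l _ => abs_apply_le (hk l) _ _))
    le_rfl)) ((abs_sub _ _).trans (add_le_add (abs_apply_le (norm_kfun_tensor_le hk) _ _) le_rfl)))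

omit [∀ l, MeasurableSpace (𝒳 l)] in
theorem exists_abs_V_le {B : ℝ} (hk : ∀ l y, ‖kfun (H l) y‖ ≤ B) :
    ∃ C, ∀ x, |V H P X x| ≤ C := by
  refine ⟨B ^ d * ‖prodMean H P X‖ + |⟪jointMean H P X, prodMean H P X⟫_ℝ|, fun x => ?_⟩
  rw [V_eq]
  exact (abs_sub _ _).trans (add_le_add (abs_apply_le (norm_kfun_tensor_le hk) _ _) le_rfl)

variable [IsProbabilityMeasure P]

theorem isMean_margMean (hK : ∀ l, Measurable fun p : 𝒳 l × 𝒳 l => kval (H l) p.1 p.2) {B : ℝ}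
    (hk : ∀ l y, ‖kfun (H l) y‖ ≤ B) (hX : AEMeasurable X P) (l : Fin d) :
    IsMean P (fun ω => kfun (H l) (X ω l)) (margMean H P X l) :=
  isMean_mean_kfun (hK l) (hk l) ((measurable_pi_apply l).comp_aemeasurable hX)

theorem isMean_jointMean (hK : ∀ l, Measurable fun p : 𝒳 l × 𝒳 l => kval (H l) p.1 p.2) {B : ℝ}
    (hk : ∀ l y, ‖kfun (H l) y‖ ≤ B) (hX : AEMeasurable X P) :
    IsMean P (fun ω => kfun (TensorHilbert H) (X ω)) (jointMean H P X) :=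
  isMean_mean_kfun (measurable_kval_tensor hK) (norm_kfun_tensor_le hk) hX

/-- Averaging over slot `l` puts `m_l` back, so each of the `d` summands has mean `⟪ν, ν - m⟫`,
cancelling the subtracted term. -/
theorem integral_U (hK : ∀ l, Measurable fun p : 𝒳 l × 𝒳 l => kval (H l) p.1 p.2) {B : ℝ}
    (hk : ∀ l y, ‖kfun (H l) y‖ ≤ B) (hX : AEMeasurable X P) :
    ∫ ω, U H P X (X ω) ∂P = 0 := by
  have i1 : ∀ l, Integrable (fun ω => (tprodSlot (margMean H P X) l).adjoint
      (prodMean H P X - jointMean H P X) (X ω l)) P := fun l =>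
    integrable_apply (hK l) (hk l) ((measurable_pi_apply l).comp_aemeasurable hX) _
  have i2 := integrable_apply (measurable_kval_tensor hK) (norm_kfun_tensor_le hk) hX
    (jointMean H P X)
  have i3 := integrable_finsetSum Finset.univ fun l _ => i1 l
  have i4 : Integrable (fun ω => ∑ l, (tprodSlot (margMean H P X) l).adjoint
      (prodMean H P X - jointMean H P X) (X ω l)
      - d * ⟪prodMean H P X, prodMean H P X - jointMean H P X⟫_ℝ) P :=
    i3.sub (integrable_const _)
  have i5 : Integrable (fun ω => jointMean H P X (X ω) - ‖jointMean H P X‖ ^ 2) P :=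
    i2.sub (integrable_const _)
  simp only [U_eq]
  rw [integral_add i4 i5, integral_sub i3 (integrable_const _),
    integral_sub i2 (integrable_const _),
    integral_finsetSum _ fun l _ => i1 l, integral_apply_eq (isMean_jointMean hK hk hX)]
  have e : ∀ l, ∫ ω, (tprodSlot (margMean H P X) l).adjoint
      (prodMean H P X - jointMean H P X) (X ω l) ∂P
      = ⟪prodMean H P X, prodMean H P X - jointMean H P X⟫_ℝ := fun l => by
    rw [integral_apply_eq (isMean_margMean hK hk hX l), ContinuousLinearMap.adjoint_inner_right,
      tprodSlot_apply, Function.update_eq_self, prodMean]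
  simp only [e]
  simp

theorem integral_V (hK : ∀ l, Measurable fun p : 𝒳 l × 𝒳 l => kval (H l) p.1 p.2) {B : ℝ}
    (hk : ∀ l y, ‖kfun (H l) y‖ ≤ B) (hX : AEMeasurable X P) :
    ∫ ω, V H P X (X ω) ∂P = 0 := by
  simp only [V_eq]
  rw [integral_sub (integrable_apply (measurable_kval_tensor hK) (norm_kfun_tensor_le hk) hX _)
    (integrable_const _), integral_apply_eq (isMean_jointMean hK hk hX)]
  simp

/-- Under joint independence, the joint mean embedding is the tensor product of the marginal
ones. -/
theorem jointMean_eq_prodMean (hK : ∀ l, Measurable fun p : 𝒳 l × 𝒳 l => kval (H l) p.1 p.2)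
    {B : ℝ} (hk : ∀ l y, ‖kfun (H l) y‖ ≤ B) (hX : AEMeasurable X P)
    (hind : P.map X = Measure.pi fun l => P.map fun ω => X ω l) :
    jointMean H P X = prodMean H P X := by
  have hXl : ∀ l, AEMeasurable (fun ω => X ω l) P := fun l =>
    (measurable_pi_apply l).comp_aemeasurable hX
  have : ∀ l, IsProbabilityMeasure (P.map fun ω => X ω l) := fun l =>
    Measure.isProbabilityMeasure_map (hXl l)
  rw [← sub_eq_zero]
  -- Elementary tensors separate points, and for them the mean of `∏ f_l(X l)` factorizes under the
  -- product law.
  refine eq_zero_of_inner_tprod fun f => ?_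
  have hmeas := measurable_of_kernel (measurable_kval_tensor hK) (tprod f)
  rw [inner_sub_right, real_inner_comm, ← integral_apply_eq (isMean_jointMean hK hk hX),
    ← integral_map hX hmeas.aestronglyMeasurable, hind]
  simp only [tprod_apply]
  rw [integral_fintype_prod_eq_prod, prodMean, inner_tprod, sub_eq_zero]
  refine Finset.prod_congr rfl fun l _ => ?_
  rw [integral_map (hXl l) (measurable_of_kernel (hK l) _).aestronglyMeasurable,
    integral_apply_eq (isMean_margMean hK hk hX l), real_inner_comm]

omit [∀ l, MeasurableSpace (𝒳 l)] [IsProbabilityMeasure P] in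
theorem U_eq_V (h : jointMean H P X = prodMean H P X) (x : ∀ l, 𝒳 l) : U H P X x = V H P X x := by
  rw [U, V, h, sub_self, inner_zero_right, zero_add]

-- This form shows nonnegativity for `W ≥ 1`, and its first term vanishes when `U = V`.
omit [∀ l, MeasurableSpace (𝒳 l)] in
theorem asympVar_eq {Y : Ω → ∀ l, 𝒳 l} (hU : MemLp (fun ω => U H P X (Y ω)) 2 P)
    (hV : MemLp (fun ω => V H P X (Y ω)) 2 P) (W : ℝ) :
    asympVar H P X W Y = 4 * Var[(fun ω => U H P X (Y ω)) - fun ω => V H P X (Y ω); P]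
      + 4 * (W - 1) * Var[fun ω => V H P X (Y ω); P] := by
  rw [asympVar, variance_sub hU hV]
  ring

omit [IsProbabilityMeasure P] in
theorem aemeasurable_estimator (hK : ∀ l, Measurable fun p : 𝒳 l × 𝒳 l => kval (H l) p.1 p.2)
    {n : ℕ} (w : Fin n → ℝ) {S : Fin n → Ω → ∀ l, 𝒳 l} (hS : ∀ i, AEMeasurable (S i) P) :
    AEMeasurable (fun ω => estimator H w fun i => S i ω) P := by
  have hSl : ∀ i l, AEMeasurable (fun ω => S i ω l) P := fun i l =>
    (measurable_pi_apply l).comp_aemeasurable (hS i)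
  have hk : ∀ l i j, AEMeasurable (fun ω => kval (H l) (S i ω l) (S j ω l)) P := by
    intro l i j
    have hc := (hK l).comp_aemeasurable ((hSl i l).prodMk (hSl j l))
    exact hc
  have h1 : ∀ i j, AEMeasurable (fun ω => ∏ l, kval (H l) (S i ω l) (S j ω l)) P := fun i j =>
    Finset.aemeasurable_fun_prod _ fun l _ => hk l i j
  have h2 : ∀ l i, AEMeasurable (fun ω => ∑ j, kval (H l) (S i ω l) (S j ω l)) P := fun l i =>
    Finset.aemeasurable_fun_sum _ fun j _ => hk l i j
  unfold estimator
  have h3 := Finset.aemeasurable_fun_sum Finset.univ fun i _ =>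
    Finset.aemeasurable_fun_sum Finset.univ fun j _ => h1 i j
  have h4 := Finset.aemeasurable_fun_prod Finset.univ fun l _ =>
    Finset.aemeasurable_fun_sum Finset.univ fun i _ => h2 l i
  have h5 := Finset.aemeasurable_fun_sum Finset.univ fun i _ =>
    (Finset.aemeasurable_fun_prod Finset.univ fun l _ => h2 l i).const_mul (w i)
  exact ((h3.const_mul _).add (h4.const_mul _)).sub (h5.const_mul _)

end Moments

/-! ### The limit theorem -/

/-- Convergence in `L¹` implies convergence in measure. The pointwise bound is only asked
eventually, as the weight condition holds only for large `n`. -/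
theorem tendstoInMeasure_zero_of_integral_bound {Ω : Type*} [MeasurableSpace Ω] {P : Measure Ω}
    {f g : ℕ → Ω → ℝ} (hf : ∀ n, AEMeasurable (f n) P) (hg : ∀ n, Integrable (g n) P)
    (hfg : ∀ᶠ n in atTop, ∀ ω, |f n ω| ≤ g n ω) {a : ℕ → ℝ} (ha : Tendsto a atTop (𝓝 0))
    (hga : ∀ n, ∫ ω, g n ω ∂P ≤ a n) : TendstoInMeasure P f atTop 0 := by
  refine tendstoInMeasure_of_tendsto_eLpNorm one_ne_zero (fun n => (hf n).aestronglyMeasurable)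
    aestronglyMeasurable_zero ?_
  have h0 : Tendsto (fun n => ENNReal.ofReal (a n)) atTop (𝓝 0) := by
    simpa using ENNReal.tendsto_ofReal ha
  refine tendsto_of_tendsto_of_tendsto_of_le_of_le' tendsto_const_nhds h0
    (Eventually.of_forall fun _ => zero_le) ?_
  filter_upwards [hfg] with n hn
  have hn0 : ∀ ω, 0 ≤ g n ω := fun ω => (abs_nonneg _).trans (hn ω)
  rw [sub_zero, eLpNorm_one_eq_lintegral_enorm]
  refine le_trans ?_ (ENNReal.ofReal_le_ofReal (hga n))
  rw [ofReal_integral_eq_lintegral_ofReal (hg n) (ae_of_all _ hn0)]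
  refine lintegral_mono fun ω => ?_
  rw [Real.enorm_eq_ofReal_abs]
  exact ENNReal.ofReal_le_ofReal (hn ω)

section Limit

variable {d : ℕ} {𝒳 : Fin d → Type*} [∀ l, MeasurableSpace (𝒳 l)] {H : Fin d → Type*}
  [∀ l, NormedAddCommGroup (H l)] [∀ l, InnerProductSpace ℝ (H l)] [∀ l, CompleteSpace (H l)]
  [∀ l, RKHS ℝ (H l) (𝒳 l) ℝ] {Ω : Type*} [MeasurableSpace Ω] {P : Measure Ω}
  [IsProbabilityMeasure P] {X : Ω → ∀ l, 𝒳 l} {S : ℕ → Ω → ∀ l, 𝒳 l}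

/-- Each term of the deterministic error bound has mean of order `1/n`, so multiplication by `√n`
leaves order `1/√n`. -/
theorem tendstoInMeasure_remainder
    (hK : ∀ l, Measurable fun p : 𝒳 l × 𝒳 l => kval (H l) p.1 p.2) {B : ℝ} (hB : 1 ≤ B)
    (hk : ∀ l y, ‖kfun (H l) y‖ ≤ B) (hindep : iIndepFun S P)
    (hident : ∀ i, IdentDistrib (S i) X P P) {w : (n : ℕ) → Fin n → ℝ} {C τ : ℝ}
    (hw : ∀ n i, |w n i| ≤ C)
    (hτ : ∀ᶠ n : ℕ in atTop, (n : ℝ) * |1 / (n : ℝ) * ∑ i, w n i - 1| ≤ τ) :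
    TendstoInMeasure P ((fun (n : ℕ) ω => √(n : ℝ) *
        (estimator H (w n) (fun i => S i ω) - dHSIC H P X))
      - fun (n : ℕ) ω => (√(n : ℝ))⁻¹ *
        ∑ i : Fin n, 2 * (U H P X (S i ω) - w n i * V H P X (S i ω))) atTop 0 := by
  have hX := (hident 0).aemeasurable_snd
  have hS : ∀ i, AEMeasurable (S i) P := fun i => (hident i).aemeasurable_fst
  have hKt := measurable_kval_tensor hK
  have hkt := norm_kfun_tensor_le hk
  have hmm := isMean_margMean hK hk hX
  have hmj := isMean_jointMean hK hk hX
  have hnm := fun l => norm_mean_le (hmm l) (hk l)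
  have hnj := norm_mean_le hmj hkt
  have hS' : ∀ n : ℕ, iIndepFun (fun i : Fin n => S i) P := fun n =>
    hindep.precomp Fin.val_injective
  have hSl : ∀ (n : ℕ) l, iIndepFun (fun (i : Fin n) ω => S i ω l) P := fun n l =>
    (hS' n).comp (fun _ x => x l) fun _ => measurable_pi_apply l
  have hidl : ∀ i l, IdentDistrib (fun ω => S i ω l) (fun ω => X ω l) P P := fun i l =>
    (hident i).comp (measurable_pi_apply l)
  set K₁ := 6 * (B ^ d) ^ 2 * (d : ℝ) with hK₁
  set K₂ := 2 * (B ^ d) ^ 2 with hK₂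
  -- The error bound with the weight bias replaced by `τ / n`, which is legitimate for large `n`.
  let q : ℕ → Ω → ℝ := fun n ω =>
    ‖centredAvg (jointMean H P X) (fun _ => 1) fun i : Fin n => S i ω‖ ^ 2
      + ‖centredAvg (jointMean H P X) (w n) fun i => S i ω‖ ^ 2
      + K₁ * ∑ l, ‖centredAvg (margMean H P X l) (fun _ => 1) fun i : Fin n => S i ω l‖ ^ 2
      + K₂ * (τ / n)
  have i1 : ∀ n : ℕ, Integrable (fun ω =>
      ‖centredAvg (jointMean H P X) (fun _ => 1) fun i : Fin n => S i ω‖ ^ 2) P := fun n =>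
    integrable_norm_centredAvg_sq hKt hkt hnj _ fun i : Fin n => hS i
  have i2 : ∀ n : ℕ, Integrable (fun ω =>
      ‖centredAvg (jointMean H P X) (w n) fun i : Fin n => S i ω‖ ^ 2) P := fun n =>
    integrable_norm_centredAvg_sq hKt hkt hnj _ fun i : Fin n => hS i
  have i3 : ∀ (n : ℕ) l, Integrable (fun ω =>
      ‖centredAvg (margMean H P X l) (fun _ => 1) fun i : Fin n => S i ω l‖ ^ 2) P := fun n l =>
    integrable_norm_centredAvg_sq (hK l) (hk l) (hnm l) _
      fun i : Fin n => (hidl i l).aemeasurable_fst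
  have i4 : ∀ n : ℕ, Integrable (fun ω =>
      ∑ l, ‖centredAvg (margMean H P X l) (fun _ => 1) fun i : Fin n => S i ω l‖ ^ 2) P := fun n =>
    integrable_finsetSum _ fun l _ => i3 n l
  have hq : ∀ n, Integrable (q n) P := fun n =>
    (((i1 n).add (i2 n)).add ((i4 n).const_mul _)).add (integrable_const _)
  set K := (2 * B ^ d * 1) ^ 2 + (2 * B ^ d * C) ^ 2 + K₁ * (d * (2 * B * 1) ^ 2) + K₂ * τ with hKdef
  have hqint : ∀ n, ∫ ω, q n ω ∂P ≤ K / n := by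
    intro n
    have b1 := integral_norm_centredAvg_sq_le hKt hkt hmj (a := fun _ : Fin n => (1 : ℝ))
      (C := 1) (by simp) (hS' n) fun i => hident i
    have b2 := integral_norm_centredAvg_sq_le hKt hkt hmj (hw n) (hS' n) fun i => hident i
    have b3 := fun l => integral_norm_centredAvg_sq_le (hK l) (hk l) (hmm l)
      (a := fun _ : Fin n => (1 : ℝ)) (C := 1) (by simp) (hSl n l) fun i => hidl i l
    have e : ∫ ω, q n ω ∂P
        = (∫ ω, ‖centredAvg (jointMean H P X) (fun _ => 1) fun i : Fin n => S i ω‖ ^ 2 ∂P)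
          + (∫ ω, ‖centredAvg (jointMean H P X) (w n) fun i => S i ω‖ ^ 2 ∂P)
          + K₁ * ∑ l, ∫ ω,
            ‖centredAvg (margMean H P X l) (fun _ => 1) fun i : Fin n => S i ω l‖ ^ 2 ∂P
          + K₂ * (τ / n) := by
      have j1 := integral_add ((i1 n).add (i2 n)) ((i4 n).const_mul K₁)
      have j2 := integral_add (((i1 n).add (i2 n)).add ((i4 n).const_mul K₁))
        (integrable_const (μ := P) (K₂ * (τ / n)))
      have j3 := integral_add (i1 n) (i2 n)
      have j4 := integral_finsetSum Finset.univ fun l _ => i3 n l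
      simp only [Pi.add_apply] at j1 j2 j3
      simp only [q]
      rw [j2, j1, j3, integral_const_mul, j4]
      simp
    have b4 : ∑ l, ∫ ω,
        ‖centredAvg (margMean H P X l) (fun _ => 1) fun i : Fin n => S i ω l‖ ^ 2 ∂P
        ≤ d * ((2 * B * 1) ^ 2 / n) := by
      refine (Finset.sum_le_sum fun l _ => b3 l).trans (le_of_eq ?_)
      simp
    have b5 := mul_le_mul_of_nonneg_left b4 (show 0 ≤ K₁ by positivity)
    rw [e]
    refine (add_le_add (add_le_add (add_le_add b1 b2) b5) le_rfl).trans (le_of_eq ?_)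
    rw [hKdef]
    ring
  refine tendstoInMeasure_zero_of_integral_bound (g := fun n ω => √(n : ℝ) * q n ω)
    (a := fun n : ℕ => K * (√(n : ℝ))⁻¹) (fun n => ?_) (fun n => (hq n).const_mul _) ?_ ?_ ?_
  · have m1 : ∀ i, AEMeasurable (fun ω => U H P X (S i ω)) P := fun i =>
      (measurable_U hK).comp_aemeasurable (hS i)
    have m2 : ∀ i, AEMeasurable (fun ω => V H P X (S i ω)) P := fun i =>
      (measurable_V hK).comp_aemeasurable (hS i)
    have m3 := aemeasurable_estimator (P := P) hK (w n) fun i : Fin n => hS i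
    refine ((m3.sub_const _).const_mul _).sub ((Finset.aemeasurable_fun_sum _ fun i _ => ?_).const_mul _)
    exact ((m1 i).sub ((m2 i).const_mul _)).const_mul _
  · filter_upwards [hτ, eventually_gt_atTop 0] with n hn hn0 ω
    have hn' : (0 : ℝ) < n := by positivity
    have h := abs_estimator_sub_linear_le H P X hB hk hnm hnj hn0 (w n) fun i => S i ω
    have hwn : |1 / (n : ℝ) * ∑ i, w n i - 1| ≤ τ / n := by
      rw [le_div_iff₀ hn', mul_comm]
      exact hn
    have hr : (√(n : ℝ))⁻¹ = √(n : ℝ) * (1 / (n : ℝ)) := by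
      have := Real.sq_sqrt hn'.le
      have hs : √(n : ℝ) ≠ 0 := (Real.sqrt_pos.2 hn').ne'
      field_simp
      linarith
    have e : ((fun (n : ℕ) ω => √(n : ℝ) * (estimator H (w n) (fun i => S i ω) - dHSIC H P X))
          - fun (n : ℕ) ω => (√(n : ℝ))⁻¹ *
            ∑ i : Fin n, 2 * (U H P X (S i ω) - w n i * V H P X (S i ω))) n ω
        = √(n : ℝ) * (estimator H (w n) (fun i => S i ω) - dHSIC H P X
          - 2 * (1 / (n : ℝ) * ∑ i : Fin n, (U H P X (S i ω) - w n i * V H P X (S i ω)))) := by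
      simp only [Pi.sub_apply]
      rw [hr, ← Finset.mul_sum]
      ring
    rw [e, abs_mul, abs_of_nonneg (Real.sqrt_nonneg _)]
    refine mul_le_mul_of_nonneg_left (h.trans ?_) (Real.sqrt_nonneg _)
    exact add_le_add le_rfl (mul_le_mul_of_nonneg_left hwn (by positivity))
  · have hs0 : Tendsto (fun n : ℕ => (√(n : ℝ))⁻¹) atTop (𝓝 0) :=
      tendsto_inv_atTop_zero.comp (Real.tendsto_sqrt_atTop.comp tendsto_natCast_atTop_atTop)
    simpa using hs0.const_mul K
  · intro n
    rw [integral_const_mul]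
    refine (mul_le_mul_of_nonneg_left (hqint n) (Real.sqrt_nonneg _)).trans (le_of_eq ?_)
    rw [mul_div_left_comm, Real.sqrt_div_self]

theorem tendsto_weight_mean {w : (n : ℕ) → Fin n → ℝ} {τ : ℝ}
    (hτ : ∀ᶠ n : ℕ in atTop, (n : ℝ) * |1 / (n : ℝ) * ∑ i, w n i - 1| ≤ τ) :
    Tendsto (fun n : ℕ => 1 / (n : ℝ) * ∑ i, w n i) atTop (𝓝 1) := by
  rw [tendsto_iff_norm_sub_tendsto_zero]
  refine squeeze_zero' (Eventually.of_forall fun _ => norm_nonneg _) ?_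
    (tendsto_const_div_atTop_nhds_zero_nat τ)
  filter_upwards [hτ, eventually_gt_atTop 0] with n hn hn0
  rw [le_div_iff₀ (by positivity), mul_comm]
  exact hn

theorem memLp_U_comp (hK : ∀ l, Measurable fun p : 𝒳 l × 𝒳 l => kval (H l) p.1 p.2) {B : ℝ}
    (hk : ∀ l y, ‖kfun (H l) y‖ ≤ B) {Y : Ω → ∀ l, 𝒳 l} (hY : AEMeasurable Y P) :
    MemLp (fun ω => U H P X (Y ω)) 2 P := by
  obtain ⟨C, hC⟩ := exists_abs_U_le (P := P) (X := X) hk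
  exact .of_bound ((measurable_U hK).comp_aemeasurable hY).aestronglyMeasurable C
    (ae_of_all _ fun ω => hC _)

theorem memLp_V_comp (hK : ∀ l, Measurable fun p : 𝒳 l × 𝒳 l => kval (H l) p.1 p.2) {B : ℝ}
    (hk : ∀ l y, ‖kfun (H l) y‖ ≤ B) {Y : Ω → ∀ l, 𝒳 l} (hY : AEMeasurable Y P) :
    MemLp (fun ω => V H P X (Y ω)) 2 P := by
  obtain ⟨C, hC⟩ := exists_abs_V_le (P := P) (X := X) hk
  exact .of_bound ((measurable_V hK).comp_aemeasurable hY).aestronglyMeasurable C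
    (ae_of_all _ fun ω => hC _)

omit [∀ l, MeasurableSpace (𝒳 l)] in
theorem asympVar_nonneg {Y : Ω → ∀ l, 𝒳 l} (hU : MemLp (fun ω => U H P X (Y ω)) 2 P)
    (hV : MemLp (fun ω => V H P X (Y ω)) 2 P) {W : ℝ} (hW : 1 ≤ W) :
    0 ≤ asympVar H P X W Y := by
  rw [asympVar_eq hU hV]
  have h1 := variance_nonneg ((fun ω => U H P X (Y ω)) - fun ω => V H P X (Y ω)) P
  have h2 := variance_nonneg (fun ω => V H P X (Y ω)) P
  have h3 : 0 ≤ W - 1 := by linarith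
  positivity

/-- The weights enter the row variances only through their first two empirical moments, with limits
`1` and `W`. The limit `1` multiplies the covariance. -/
theorem tendstoInDistribution_linear
    (hK : ∀ l, Measurable fun p : 𝒳 l × 𝒳 l => kval (H l) p.1 p.2) {B : ℝ}
    (hk : ∀ l y, ‖kfun (H l) y‖ ≤ B) (hindep : iIndepFun S P)
    (hident : ∀ i, IdentDistrib (S i) X P P) {w : (n : ℕ) → Fin n → ℝ} {C τ W : ℝ}
    (hw : ∀ n i, |w n i| ≤ C)
    (hτ : ∀ᶠ n : ℕ in atTop, (n : ℝ) * |1 / (n : ℝ) * ∑ i, w n i - 1| ≤ τ)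
    (hsq : Tendsto (fun n : ℕ => 1 / (n : ℝ) * ∑ i, w n i ^ 2) atTop (𝓝 W)) (hW : 1 ≤ W) :
    TendstoInDistribution (fun (n : ℕ) ω => (√(n : ℝ))⁻¹ *
        ∑ i : Fin n, 2 * (U H P X (S i ω) - w n i * V H P X (S i ω)))
      atTop id (fun _ => P) (gaussianReal 0 (asympVar H P X W (S 0)).toNNReal) := by
  have hX := (hident 0).aemeasurable_snd
  have hS : ∀ i, AEMeasurable (S i) P := fun i => (hident i).aemeasurable_fst
  have mU : Measurable (U H P X) := measurable_U hK
  have mV : Measurable (V H P X) := measurable_V hK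
  have lU : ∀ i, MemLp (fun ω => U H P X (S i ω)) 2 P := fun i => memLp_U_comp hK hk (hS i)
  have lV : ∀ i, MemLp (fun ω => V H P X (S i ω)) 2 P := fun i => memLp_V_comp hK hk (hS i)
  obtain ⟨CU, hCU⟩ := exists_abs_U_le (P := P) (X := X) hk
  obtain ⟨CV, hCV⟩ := exists_abs_V_le (P := P) (X := X) hk
  have hid : ∀ i, IdentDistrib (S i) (S 0) P P := fun i => (hident i).trans (hident 0).symm
  have zU : ∀ i, ∫ ω, U H P X (S i ω) ∂P = 0 := fun i =>
    ((hident i).comp mU).integral_eq.trans (integral_U hK hk hX)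
  have zV : ∀ i, ∫ ω, V H P X (S i ω) ∂P = 0 := fun i =>
    ((hident i).comp mV).integral_eq.trans (integral_V hK hk hX)
  have iU : ∀ i, Integrable (fun ω => U H P X (S i ω)) P := fun i => (lU i).integrable one_le_two
  have iV : ∀ i, Integrable (fun ω => V H P X (S i ω)) P := fun i => (lV i).integrable one_le_two
  have vU : Var[fun ω => U H P X (S 0 ω); P] = ∫ ω, U H P X (S 0 ω) ^ 2 ∂P :=
    variance_of_integral_eq_zero (lU 0).aestronglyMeasurable.aemeasurable (zU 0)
  have vV : Var[fun ω => V H P X (S 0 ω); P] = ∫ ω, V H P X (S 0 ω) ^ 2 ∂P :=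
    variance_of_integral_eq_zero (lV 0).aestronglyMeasurable.aemeasurable (zV 0)
  have cUV : cov[fun ω => U H P X (S 0 ω), fun ω => V H P X (S 0 ω); P]
      = ∫ ω, U H P X (S 0 ω) * V H P X (S 0 ω) ∂P := by
    rw [covariance_eq_sub (lU 0) (lV 0), zU, zero_mul, sub_zero]
    rfl
  have hmeas : ∀ c : ℝ, Measurable fun x => 2 * (U H P X x - c * V H P X x) := fun c =>
    (mU.sub (mV.const_mul c)).const_mul 2
  -- `U` and `V` are centred, so variances and covariance are plain second moments; identical laws
  -- allow `S i` to be replaced by `S 0`.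
  have hmoment : ∀ (c : ℝ) i, ∫ ω, (2 * (U H P X (S i ω) - c * V H P X (S i ω))) ^ 2 ∂P
      = 4 * Var[fun ω => U H P X (S 0 ω); P] + 4 * Var[fun ω => V H P X (S 0 ω); P] * c ^ 2
        - 8 * cov[fun ω => U H P X (S 0 ω), fun ω => V H P X (S 0 ω); P] * c := by
    intro c i
    have e1 := ((hid i).comp ((hmeas c).pow_const 2)).integral_eq
    refine e1.trans ?_
    rw [vU, vV, cUV]
    have k1 : Integrable (fun ω => U H P X (S 0 ω) ^ 2) P := (lU 0).integrable_sq
    have k2 : Integrable (fun ω => V H P X (S 0 ω) ^ 2) P := (lV 0).integrable_sq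
    have k3 : Integrable (fun ω => U H P X (S 0 ω) * V H P X (S 0 ω)) P :=
      (lU 0).integrable_mul (lV 0)
    have e2 : ∀ ω, ((fun x => (2 * (U H P X x - c * V H P X x)) ^ 2) ∘ S 0) ω
        = 4 * U H P X (S 0 ω) ^ 2 + 4 * c ^ 2 * V H P X (S 0 ω) ^ 2
          - 8 * c * (U H P X (S 0 ω) * V H P X (S 0 ω)) := fun ω => by
      simp only [Function.comp_apply]
      ring
    have k4 : Integrable (fun ω => 4 * U H P X (S 0 ω) ^ 2 + 4 * c ^ 2 * V H P X (S 0 ω) ^ 2) P :=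
      (k1.const_mul _).add (k2.const_mul _)
    simp only [e2]
    rw [integral_sub k4 (k3.const_mul _), integral_add (k1.const_mul _) (k2.const_mul _),
      integral_const_mul, integral_const_mul, integral_const_mul]
    ring
  refine tendstoInDistribution_bounded_array (B := 2 * (CU + C * CV))
    (Z := fun n i ω => 2 * (U H P X (S i ω) - w n i * V H P X (S i ω))) (fun n => ?_)
    (fun n i => ?_) (fun n i ω => ?_) (fun n i => ?_) (asympVar_nonneg (lU 0) (lV 0) hW) ?_
  · exact (hindep.precomp Fin.val_injective).comp
      (fun (i : Fin n) x => 2 * (U H P X x - w n i * V H P X x)) fun i => hmeas _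
  · exact (hmeas (w n i)).comp_aemeasurable (hS i)
  · rw [abs_mul, abs_two]
    refine mul_le_mul_of_nonneg_left ((abs_sub _ _).trans (add_le_add (hCU _) ?_)) zero_le_two
    rw [abs_mul]
    exact mul_le_mul (hw n i) (hCV _) (abs_nonneg _) ((abs_nonneg _).trans (hw n i))
  · rw [integral_const_mul, integral_sub (iU i) ((iV i).const_mul _), integral_const_mul, zU, zV]
    simp
  · simp only [hmoment]
    have hlim := ((tendsto_const_nhds (x := 4 * Var[fun ω => U H P X (S 0 ω); P])).add
      (hsq.const_mul (4 * Var[fun ω => V H P X (S 0 ω); P]))).sub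
      ((tendsto_weight_mean hτ).const_mul
        (8 * cov[fun ω => U H P X (S 0 ω), fun ω => V H P X (S 0 ω); P]))
    have e : asympVar H P X W (S 0) = 4 * Var[fun ω => U H P X (S 0 ω); P]
        + 4 * Var[fun ω => V H P X (S 0 ω); P] * W
        - 8 * cov[fun ω => U H P X (S 0 ω), fun ω => V H P X (S 0 ω); P] * 1 := by
      rw [asympVar]
      ring
    rw [e]
    refine hlim.congr' ?_
    -- The constant term is `n` times `1/n`, which is `1` only for `n > 0`.
    filter_upwards [eventually_gt_atTop 0] with n hn
    rw [Finset.sum_sub_distrib, Finset.sum_add_distrib, ← Finset.mul_sum _ (fun i => w n i ^ 2),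
      ← Finset.mul_sum _ (fun i => w n i), Finset.sum_const, Finset.card_univ, Fintype.card_fin, nsmul_eq_mul]
    have hn' : (n : ℝ) ≠ 0 := by positivity
    field_simp

end Limit

end DHSIC

/-! ### Assembly of the theorem -/

theorem theorem1 {d : ℕ} (hd : 2 ≤ d)
    {𝒳 : Fin d → Type*} [∀ l, MetricSpace (𝒳 l)] [∀ l, CompactSpace (𝒳 l)]
    [∀ l, MeasurableSpace (𝒳 l)] [∀ l, BorelSpace (𝒳 l)]
    (H : Fin d → Type*) [∀ l, NormedAddCommGroup (H l)] [∀ l, InnerProductSpace ℝ (H l)]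
    [∀ l, CompleteSpace (H l)] [∀ l, RKHS ℝ (H l) (𝒳 l) ℝ]
    (hKmeas : ∀ l, Measurable fun p : 𝒳 l × 𝒳 l => DHSIC.kval (H l) p.1 p.2)
    (hKbdd : ∀ l, BddAbove (Set.range fun p : 𝒳 l × 𝒳 l => DHSIC.kval (H l) p.1 p.2))
    {Ω : Type*} [MeasurableSpace Ω] (P : Measure Ω) [IsProbabilityMeasure P]
    (X : Ω → ∀ l, 𝒳 l) (S : ℕ → Ω → ∀ l, 𝒳 l)
    (hindep : iIndepFun S P) (hident : ∀ i, IdentDistrib (S i) X P P)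
    (w : ℝ → (n : ℕ) → Fin n → ℝ) (w2 : ℝ → ℝ) (hw : DHSIC.WeightConditions w w2) :
    (∀ l, DHSIC.IsMean P (fun ω => DHSIC.kfun (H l) (X ω l)) (DHSIC.margMean H P X l)) ∧
    DHSIC.IsMean P (fun ω => DHSIC.kfun (DHSIC.TensorHilbert H) (X ω))
      (DHSIC.jointMean H P X) ∧
    MemLp (fun ω => DHSIC.U H P X (S 0 ω)) 2 P ∧
    MemLp (fun ω => DHSIC.V H P X (S 0 ω)) 2 P ∧
    ∀ γ ∈ Set.Ioc (0 : ℝ) 1,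
      0 ≤ DHSIC.asympVar H P X (w2 γ) (S 0) ∧
      TendstoInDistribution
        (fun (n : ℕ) ω => √(n : ℝ) *
          (DHSIC.estimator H (w γ n) (fun i => S i ω) - DHSIC.dHSIC H P X))
        atTop id (fun _ => P)
        (gaussianReal 0 (DHSIC.asympVar H P X (w2 γ) (S 0)).toNNReal) ∧
      (P.map X = Measure.pi (fun l => P.map fun ω => X ω l) →
        TendstoInDistribution
          (fun (n : ℕ) ω => √(n : ℝ) * DHSIC.estimator H (w γ n) (fun i => S i ω))
          atTop id (fun _ => P)
          (gaussianReal 0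
            (4 * (w2 γ - 1) * Var[fun ω => DHSIC.V H P X (S 0 ω); P]).toNNReal)) := by
  obtain ⟨B, hB, hk⟩ : ∃ B : ℝ, 1 ≤ B ∧ ∀ l y, ‖DHSIC.kfun (H l) y‖ ≤ B := by
    choose b hb1 hb using fun l => DHSIC.exists_norm_kfun_le (hKbdd l)
    -- One bound for all factors; the summand `1` keeps it at least `1` without appeal to `d > 0`.
    refine ⟨1 + ∑ l, b l, ?_, fun l y => (hb l y).trans ?_⟩
    · linarith [Finset.sum_nonneg fun l (_ : l ∈ Finset.univ) => zero_le_one.trans (hb1 l)]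
    · linarith [Finset.single_le_sum (f := b) (fun l _ => zero_le_one.trans (hb1 l))
        (Finset.mem_univ l)]
  have hX := (hident 0).aemeasurable_snd
  have hS : ∀ i, AEMeasurable (S i) P := fun i => (hident i).aemeasurable_fst
  have lU : MemLp (fun ω => DHSIC.U H P X (S 0 ω)) 2 P := DHSIC.memLp_U_comp hKmeas hk (hS 0)
  have lV : MemLp (fun ω => DHSIC.V H P X (S 0 ω)) 2 P := DHSIC.memLp_V_comp hKmeas hk (hS 0)
  refine ⟨DHSIC.isMean_margMean hKmeas hk hX, DHSIC.isMean_jointMean hKmeas hk hX, lU, lV,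
    fun γ hγ => ?_⟩
  obtain ⟨τ, -, n₀, hτ⟩ := hw.mean_bound γ hγ
  have hτ' : ∀ᶠ n : ℕ in atTop, (n : ℝ) * |1 / (n : ℝ) * ∑ i, w γ n i - 1| ≤ τ :=
    (eventually_gt_atTop n₀).mono hτ
  obtain ⟨C, -, hC⟩ := hw.bounded
  have hwC : ∀ n i, |w γ n i| ≤ C := fun n i => by
    rw [abs_of_nonneg (hw.nonneg γ hγ n i)]
    exact (hC n γ hγ i).le
  have hW := (hw.one_lt γ hγ).le
  have hmain : TendstoInDistribution
      (fun (n : ℕ) ω => √(n : ℝ) *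
        (DHSIC.estimator H (w γ n) (fun i => S i ω) - DHSIC.dHSIC H P X))
      atTop id (fun _ => P)
      (gaussianReal 0 (DHSIC.asympVar H P X (w2 γ) (S 0)).toNNReal) :=
    -- Slutsky: the scaled error differs from the linear part by a remainder tending to zero in
    -- measure.
    tendstoInDistribution_of_tendstoInMeasure_sub _ _
      (DHSIC.tendstoInDistribution_linear hKmeas hk hindep hident hwC hτ'
        (hw.tendsto_sq γ hγ) hW)
      (DHSIC.tendstoInMeasure_remainder hKmeas hB hk hindep hident hwC hτ')
      fun n => ((DHSIC.aemeasurable_estimator hKmeas (w γ n)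
        fun i : Fin n => hS i).sub_const _).const_mul _
  refine ⟨DHSIC.asympVar_nonneg lU lV hW, hmain, fun hind => ?_⟩
  have hmν := DHSIC.jointMean_eq_prodMean hKmeas hk hX hind
  have e1 : DHSIC.dHSIC H P X = 0 := by simp [DHSIC.dHSIC, hmν]
  have e2 : DHSIC.asympVar H P X (w2 γ) (S 0)
      = 4 * (w2 γ - 1) * Var[fun ω => DHSIC.V H P X (S 0 ω); P] := by
    rw [DHSIC.asympVar_eq lU lV]
    simp [DHSIC.U_eq_V hmν]
  simpa only [e1, e2, sub_zero] using hmain
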